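/- Let $p \ge 5$ be a prime, let $\alpha$ be an integer whose reduction modulo $p$ has multiplicative order $p-1$, and put $n = \frac{p-1}{2}$. For $\mathbf{a} = (a_1,a_2) \in \mathbb{Q}^2 \setminus \mathbb{Z}^2$ and $\tau$ in the upper half plane $\mathbb{H}$, let $$g_{\mathbf a}(\tau) = -\,e^{2\pi i a_2(a_1-1)/2}\, q_\tau^{B_2(a_1)/2}\,(1-q_z)\prod_{m=1}^{\infty}(1-q_\tau^m q_z)(1-q_\tau^m/q_z)$$ be the Siegel function, where $z = a_1\tau + a_2$, $q_\tau = e^{2\pi i\tau}$, $q_\tau^r = e^{2\pi i r\tau}$ for $r\in\mathbb{Q}$, $q_z = e^{2\pi i z}$ and $B_2(x) = x^2 - x + \frac16$. For $0 \le i \le n-1$ define $$E_i(\tau) = g_{\left(\frac{\alpha^i}{p},\,0\right)}(\tau)\prod_{j=0}^{p-2} g_{\left(\frac{\alpha^i}{p},\,\frac{\alpha^j}{p}\right)}(\tau), \qquad F_i(\tau) = g_{\left(0,\,\frac{\alpha^i}{p}\right)}(\tau).$$ A modular unit for a congruence subgroup $\Gamma \subseteq \mathrm{SL}_2(\mathbb{Z})$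 is a meromorphic function on $\mathbb{H}$ with no zeros or poles in $\mathbb{H}$ which is invariant under the action of $\Gamma$. **Proposition.** Let $e_i, f_i \in \mathbb{Z}$ for $0 \le i \le n-1$, and set $$f(\tau) = \prod_{i=0}^{n-1} E_i(\tau)^{e_i} F_i(\tau)^{f_i}.$$ Then $f$ is a modular unit for $\Gamma_1(p)$ if and only if the following three congruences hold: $$\sum_{i=0}^{n-1} e_i\alpha^{2i} \equiv 0 \pmod p, \qquad \sum_{i=0}^{n-1} f_i\alpha^{2i} \equiv 0 \pmod p, \qquad \sum_{i=0}^{n-1} (p e_i + f_i) \equiv 0 \pmod{12}.$$ The same equivalence holds if modular units are moreover required to be meromorphic at all cusps, that is, to be meromorphic functions on the complete modular curve $X_1(p)$ with divisor supported on the cusps. -/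

import Mathlib

open scoped UpperHalfPlane MatrixGroups Manifold

noncomputable section

namespace ModularUnits

/-- The second Bernoulli polynomial `B₂(x) = x² - x + 1/6`. -/
def B2 (x : ℚ) : ℚ := x ^ 2 - x + 1 / 6

/-- `q_τ = e^{2πiτ}`. -/
def qTau (τ : ℍ) : ℂ := Complex.exp (2 * Real.pi * Complex.I * (τ : ℂ))

/-- `q_z = e^{2πiz}` with `z = a₁ τ + a₂`. -/
def qZ (a₁ a₂ : ℚ) (τ : ℍ) : ℂ :=
  Complex.exp (2 * Real.pi * Complex.I * ((a₁ : ℂ) * (τ : ℂ) + (a₂ : ℂ)))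

/-- The Siegel function
`g_a(τ) = - e^{2πi a₂(a₁-1)/2} q_τ^{B₂(a₁)/2} (1 - q_z) ∏_{n ≥ 1} (1 - q_τⁿ q_z)(1 - q_τⁿ / q_z)`,
where `q_τ^r` means `e^{2πi r τ}`. The factor of index `n : ℕ` below is the one for `n + 1`. -/
def siegel (a₁ a₂ : ℚ) (τ : ℍ) : ℂ :=
  -Complex.exp (2 * Real.pi * Complex.I * ((a₂ : ℂ) * ((a₁ : ℂ) - 1) / 2)) *
    Complex.exp (2 * Real.pi * Complex.I * ((B2 a₁ : ℂ) / 2) * (τ : ℂ)) *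
    (1 - qZ a₁ a₂ τ) *
    ∏' n : ℕ, ((1 - qTau τ ^ (n + 1) * qZ a₁ a₂ τ) * (1 - qTau τ ^ (n + 1) / qZ a₁ a₂ τ))

/-- `E_i = g_{(αⁱ/p, 0)} ∏_{j=0}^{p-2} g_{(αⁱ/p, αʲ/p)}`. -/
def E (p : ℕ) (α : ℤ) (i : ℕ) (τ : ℍ) : ℂ :=
  siegel ((α : ℚ) ^ i / p) 0 τ *
    ∏ j ∈ Finset.range (p - 1), siegel ((α : ℚ) ^ i / p) ((α : ℚ) ^ j / p) τ

/-- `F_i = g_{(0, αⁱ/p)}`. -/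
def F (p : ℕ) (α : ℤ) (i : ℕ) (τ : ℍ) : ℂ :=
  siegel 0 ((α : ℚ) ^ i / p) τ

/-- `f = ∏_{i=0}^{n-1} E_i^{e_i} F_i^{f_i}` with `n = (p-1)/2`. -/
def unitProduct (p : ℕ) (α : ℤ) (e f : Fin ((p - 1) / 2) → ℤ) (τ : ℍ) : ℂ :=
  ∏ i : Fin ((p - 1) / 2), E p α (i : ℕ) τ ^ e i * F p α (i : ℕ) τ ^ f i

/-- A modular unit for `Γ`: a meromorphic function on the upper half plane without poles
(that is, a holomorphic one) and without zeros, which is invariant under `Γ`. -/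
structure IsModularUnit (Γ : Subgroup SL(2, ℤ)) (f : ℍ → ℂ) : Prop where
  holomorphic : MDifferentiable 𝓘(ℂ) 𝓘(ℂ) f
  ne_zero : ∀ τ : ℍ, f τ ≠ 0
  invariant : ∀ γ ∈ Γ, ∀ τ : ℍ, f (γ • τ) = f τ

/-- `f` is meromorphic at every cusp `γ(i∞)`: near `i∞` the function `τ ↦ f(γτ)` is a function of
`e^{2πiτ/h}`, for some integer `h ≥ 1`, that is meromorphic at `0`. -/
def MeromorphicAtCusps (f : ℍ → ℂ) : Prop :=
  ∀ γ : SL(2, ℤ), ∃ (h : ℕ) (φ : ℂ → ℂ), 0 < h ∧ MeromorphicAt φ 0 ∧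
    ∀ᶠ τ : ℍ in UpperHalfPlane.atImInfty,
      f (γ • τ) = φ (Complex.exp (2 * Real.pi * Complex.I * (τ : ℂ) / h))

/-- A modular unit on the complete modular curve `X_Γ`: a meromorphic function on `X_Γ`
whose divisor is supported on the cusps. -/
structure IsModularUnitOnCurve (Γ : Subgroup SL(2, ℤ)) (f : ℍ → ℂ) : Prop
    extends IsModularUnit Γ f where
  meromorphicAtCusps : MeromorphicAtCusps f

end ModularUnits

end

noncomputable section

namespace ModularUnits

open Filter Topology Asymptotics
open scoped Real

/-! Everything rests on one law: under `γ ∈ SL(2, ℤ)` a Siegel function of index `a` becomes `k`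
times the one of index `aγ`, where `k ^ 12 = 1` and `k` depends on `γ` only (`exists_siegel_smul`).
Jacobi's triple product turns a Siegel function into theta over eta, so the law for `S` comes from
their functional equations; `T` is visible on the product, and `S`, `T` generate.

Translating an index by an integral vector multiplies the function by a constant. Since 2 is
invertible mod `p`, indices may be written `(2v/p, 2w/p)`; translations by even vectors then
contribute pure powers of `ζ = e^{2πi/p}`, without signs (`levelSiegel_add`). For `γ ∈ Γ₁(p)` with
upper right entry `b` and lower left entry `pC`, and `2u ≡ αⁱ`, the index of `F_i` is fixed mod `p`
and yields `k ζ^{-2Cu²}`, while the `p` indices in `E_i` are permuted mod `p` and yield `k^p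
ζ^{2bu²}`. Hence `f` acquires the factor `k^{Σ(p e_i + f_i)} ζ^{2(b Σ e_i u_i² - C Σ f_i u_i²)}`
(`unitProduct_smul`).

As `4u_i² ≡ α^{2i}`, the congruences make this factor 1. Conversely `T` has `k` a primitive twelfth
root of unity, `b = 1`, `C = 0`; as 12 and `p` are coprime, invariance gives two congruences, and
the matrix with lower left entry `p` gives the third.

At the cusps, each Siegel function is comparable to an exponential of `Im τ`, so `f ∘ γ` has at most
a pole in the local parameter. -/

/-! ### Jacobi's triple product identity -/

/-- The Gaussian binomial coefficient, defined by its Pascal recursion. -/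
def gaussBinom (q : ℂ) : ℕ → ℕ → ℂ
  | _, 0 => 1
  | 0, _ + 1 => 0
  | M + 1, j + 1 => q ^ (j + 1) * gaussBinom q M (j + 1) + gaussBinom q M j

/-- The finite `q`-Pochhammer symbol `∏_{i = 1}^{n} (1 - qⁱ)`. -/
def qPoch (q : ℂ) (n : ℕ) : ℂ := ∏ i ∈ Finset.range n, (1 - q ^ (i + 1))

lemma gaussBinom_zero_right (q : ℂ) (M : ℕ) : gaussBinom q M 0 = 1 := by
  cases M <;> rfl

lemma gaussBinom_eq_zero (q : ℂ) {M j : ℕ} (h : M < j) : gaussBinom q M j = 0 := by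
  induction M generalizing j with
  | zero =>
    obtain ⟨j, rfl⟩ := Nat.exists_eq_succ_of_ne_zero h.ne'
    rfl
  | succ M ih =>
    obtain ⟨j, rfl⟩ := Nat.exists_eq_succ_of_ne_zero (Nat.ne_zero_of_lt h)
    simp [gaussBinom, ih (show M < j + 1 by omega), ih (show M < j by omega)]

lemma qPoch_succ (q : ℂ) (n : ℕ) : qPoch q (n + 1) = qPoch q n * (1 - q ^ (n + 1)) :=
  Finset.prod_range_succ _ _

lemma gaussBinom_self (q : ℂ) (M : ℕ) : gaussBinom q M M = 1 := by
  induction M with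
  | zero => rfl
  | succ M ih => simp [gaussBinom, ih, gaussBinom_eq_zero q (Nat.lt_succ_self M)]

/-- The product formula in division-free form, so that the Pascal recursion proves it for every `q`,
roots of unity included. -/
lemma gaussBinom_mul_qPoch (q : ℂ) (j k : ℕ) :
    gaussBinom q (j + k) j * qPoch q j * qPoch q k = qPoch q (j + k) := by
  induction j generalizing k with
  | zero => simp [gaussBinom_zero_right, qPoch]
  | succ j ihj =>
    induction k with
    | zero => simp [gaussBinom_self, qPoch]
    | succ k ihk =>
      have h1 := ihj (k + 1)
      have e1 : j + 1 + (k + 1) = (j + 1 + k) + 1 := by ring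
      have e2 : j + (k + 1) = j + 1 + k := by ring
      rw [e2] at h1
      rw [e1, gaussBinom, qPoch_succ q k, qPoch_succ q j, qPoch_succ q (j + 1 + k)]
      rw [qPoch_succ q k] at h1
      rw [qPoch_succ q j] at ihk
      have : q ^ (j + 1 + k + 1) = q ^ (j + 1) * q ^ (k + 1) := by rw [← pow_add]; ring_nf
      rw [this]
      linear_combination (q ^ (j + 1) * (1 - q ^ (k + 1))) * ihk + (1 - q ^ (j + 1)) * h1

/-- The `q`-binomial theorem, with `q = Q²`. -/
lemma prod_one_add_mul_pow (Q y : ℂ) (M : ℕ) :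
    ∏ k ∈ Finset.range M, (1 + y * Q ^ (2 * k)) =
      ∑ j ∈ Finset.range (M + 1), gaussBinom (Q ^ 2) M j * Q ^ (j * (j - 1)) * y ^ j := by
  induction M generalizing y with
  | zero => simp [gaussBinom]
  | succ M ih =>
    -- Splitting off the factor `k = 0` leaves the same product with `y` replaced by `y * Q ^ 2`.
    rw [Finset.prod_range_succ', mul_zero, pow_zero, mul_one]
    have h1 : ∀ k, (1 + y * Q ^ (2 * (k + 1))) = 1 + (y * Q ^ 2) * Q ^ (2 * k) := by
      intro k; ring
    simp_rw [h1]
    rw [ih, Finset.sum_range_succ' _ (M + 1)]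
    have h2 : ∀ j, gaussBinom (Q ^ 2) (M + 1) (j + 1) * Q ^ ((j + 1) * (j + 1 - 1)) * y ^ (j + 1)
        = gaussBinom (Q ^ 2) M (j + 1) * Q ^ ((j + 1) * (j + 1 - 1)) * (y * Q ^ 2) ^ (j + 1) +
          y * (gaussBinom (Q ^ 2) M j * Q ^ (j * (j - 1)) * (y * Q ^ 2) ^ j) := by
      intro j
      have h3 : Q ^ ((j + 1) * (j + 1 - 1)) = Q ^ (j * (j - 1)) * (Q ^ 2) ^ j := by
        rw [← pow_mul, ← pow_add]
        congr 1
        cases j with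
        | zero => simp
        | succ j => simp; ring
      rw [gaussBinom, h3]
      ring
    simp_rw [h2]
    rw [Finset.sum_add_distrib, ← Finset.mul_sum, add_right_comm]
    have h4 := Finset.sum_range_succ'
      (fun j ↦ gaussBinom (Q ^ 2) M j * Q ^ (j * (j - 1)) * (y * Q ^ 2) ^ j) (M + 1)
    rw [Finset.sum_range_succ, gaussBinom_eq_zero _ (Nat.lt_succ_self M)] at h4
    simp only [zero_mul, add_zero, gaussBinom_zero_right, pow_zero] at h4 ⊢
    rw [← h4]
    ring

/-- The finite form of Jacobi's triple product identity. -/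
lemma finite_triple_product {Q x : ℂ} (hQ : Q ≠ 0) (hx : x ≠ 0) (N : ℕ) :
    ∏ i ∈ Finset.range N, ((1 - x * Q ^ (2 * i)) * (1 - Q ^ (2 * (i + 1)) / x)) =
      ∑ j ∈ Finset.range (2 * N + 1), gaussBinom (Q ^ 2) (2 * N) j *
        ((-x) ^ ((j : ℤ) - N) * Q ^ (((j : ℤ) - N) * ((j : ℤ) - N - 1))) := by
  have hx' : -x ≠ 0 := neg_ne_zero.mpr hx
  -- With this `y`, the upper `N` factors are `1 - x Q^{2i}`; the lower `N`, reversed, become `1 -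
  -- Q^{2(i+1)}/x` once `-x Q^{-2(i+1)}` is pulled out.
  have key := prod_one_add_mul_pow Q (-x * (Q ^ (2 * N))⁻¹) (2 * N)
  have hprod : ∏ k ∈ Finset.range (2 * N), (1 + -x * (Q ^ (2 * N))⁻¹ * Q ^ (2 * k)) =
      (∏ i ∈ Finset.range N, ((1 - x * Q ^ (2 * i)) * (1 - Q ^ (2 * (i + 1)) / x))) *
        ((-x) ^ (N : ℤ) * Q ^ (-((N : ℤ) * (N + 1)))) := by
    have hlow : ∏ k ∈ Finset.range N, (1 + -x * (Q ^ (2 * N))⁻¹ * Q ^ (2 * k)) =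
        (∏ i ∈ Finset.range N, (1 - Q ^ (2 * (i + 1)) / x)) *
          ((-x) ^ (N : ℤ) * Q ^ (-((N : ℤ) * (N + 1)))) := by
      rw [← Finset.prod_range_reflect]
      have : ∀ i ∈ Finset.range N, (1 + -x * (Q ^ (2 * N))⁻¹ * Q ^ (2 * (N - 1 - i))) =
          (1 - Q ^ (2 * (i + 1)) / x) * (-x * (Q ^ (2 * (i + 1)))⁻¹) := by
        intro i hi
        have hi := Finset.mem_range.mp hi
        have : Q ^ (2 * N) = Q ^ (2 * (N - 1 - i)) * Q ^ (2 * (i + 1)) := by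
          rw [← pow_add]; congr 1; omega
        rw [this]
        field_simp
        ring
      rw [Finset.prod_congr rfl this, Finset.prod_mul_distrib, Finset.prod_mul_distrib,
        Finset.prod_const, Finset.card_range, zpow_natCast]
      congr 2
      clear this hx' key hx
      induction N with
      | zero => simp
      | succ N ih =>
        rw [Finset.prod_range_succ, ih, ← zpow_natCast, ← zpow_neg, ← zpow_add₀ hQ]
        congr 1
        push_cast
        ring
    rw [two_mul N, Finset.prod_range_add, ← two_mul, hlow, Finset.prod_mul_distrib]
    have : ∀ i, (1 + -x * (Q ^ (2 * N))⁻¹ * Q ^ (2 * (N + i))) = 1 - x * Q ^ (2 * i) := by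
      intro i
      rw [mul_add, pow_add]
      field_simp
      ring
    simp_rw [this]
    ring
  rw [hprod] at key
  have hne : (-x) ^ (N : ℤ) * Q ^ (-((N : ℤ) * (N + 1))) ≠ 0 :=
    mul_ne_zero (zpow_ne_zero _ hx') (zpow_ne_zero _ hQ)
  refine mul_right_cancel₀ hne (key.trans ?_)
  rw [Finset.sum_mul]
  refine Finset.sum_congr rfl fun j _ ↦ ?_
  have e1 : Q ^ (j * (j - 1)) = Q ^ ((j : ℤ) * ((j : ℤ) - 1)) := by
    rw [← zpow_natCast]
    congr 1
    cases j <;> simp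
  have e2 : (-x * (Q ^ (2 * N))⁻¹) ^ j = (-x) ^ (j : ℤ) * Q ^ (-(2 * (N : ℤ) * j)) := by
    rw [mul_pow, inv_pow, ← pow_mul, zpow_natCast, zpow_neg]
    norm_cast
  have e3 : (-x) ^ ((j : ℤ) - N) * (-x) ^ (N : ℤ) = (-x) ^ (j : ℤ) := by
    rw [← zpow_add₀ hx']; ring_nf
  have e4 : Q ^ (((j : ℤ) - N) * ((j : ℤ) - N - 1)) * Q ^ (-((N : ℤ) * (N + 1))) =
      Q ^ ((j : ℤ) * ((j : ℤ) - 1)) * Q ^ (-(2 * (N : ℤ) * j)) := by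
    rw [← zpow_add₀ hQ, ← zpow_add₀ hQ]; ring_nf
  rw [e1, e2, ← e3]
  linear_combination (-gaussBinom (Q ^ 2) (2 * N) j * (-x) ^ ((j : ℤ) - N) * (-x) ^ (N : ℤ)) * e4

/-- The coefficient of the finite triple product at `n`. -/
def tripleCoeff (q : ℂ) (N : ℕ) (n : ℤ) : ℂ :=
  -- Above `N` the Gaussian binomial vanishes by itself; below `-N` the test is needed, since
  -- `toNat` would truncate to 0 and give 1.
  if -(N : ℤ) ≤ n then gaussBinom q (2 * N) (n + N).toNat else 0

lemma tripleCoeff_mul_qPoch (q : ℂ) {N : ℕ} {n : ℤ} (h1 : -(N : ℤ) ≤ n) (h2 : n ≤ N) :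
    tripleCoeff q N n * qPoch q (N + n).toNat * qPoch q (N - n).toNat = qPoch q (2 * N) := by
  have h3 : 2 * N = (n + N).toNat + (N - n).toNat := by omega
  rw [tripleCoeff, if_pos h1, add_comm (N : ℤ) n, h3, gaussBinom_mul_qPoch]

lemma tripleCoeff_eq_zero (q : ℂ) {N : ℕ} {n : ℤ} (h : ¬(-(N : ℤ) ≤ n ∧ n ≤ N)) :
    tripleCoeff q N n = 0 := by
  rw [tripleCoeff]
  split_ifs with h1
  · exact gaussBinom_eq_zero _ (by omega)
  · rfl

lemma sum_gaussBinom_eq_tsum (q : ℂ) (N : ℕ) (t : ℤ → ℂ) :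
    ∑ j ∈ Finset.range (2 * N + 1), gaussBinom q (2 * N) j * t ((j : ℤ) - N) =
      ∑' n : ℤ, tripleCoeff q N n * t n := by
  rw [tsum_eq_sum (s := (Finset.range (2 * N + 1)).map
    ⟨fun j : ℕ ↦ (j : ℤ) - N, fun a b h ↦ by simpa using h⟩)]
  · rw [Finset.sum_map]
    refine Finset.sum_congr rfl fun j _ ↦ ?_
    change _ = tripleCoeff q N ((j : ℤ) - N) * t ((j : ℤ) - N)
    simp [tripleCoeff]
  · intro n hn
    rw [tripleCoeff_eq_zero, zero_mul]
    rintro ⟨h1, h2⟩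
    refine hn (Finset.mem_map.mpr ⟨(n + N).toNat, Finset.mem_range.mpr (by omega), ?_⟩)
    change ((n + N).toNat : ℤ) - N = n
    omega

lemma one_sub_pow_ne_zero {q : ℂ} (hq : ‖q‖ < 1) (n : ℕ) : 1 - q ^ (n + 1) ≠ 0 := by
  intro h
  have h1 : q ^ (n + 1) = 1 := (sub_eq_zero.mp h).symm
  have h2 : ‖q‖ ^ (n + 1) < 1 := pow_lt_one₀ (norm_nonneg _) hq (Nat.succ_ne_zero n)
  rw [← norm_pow, h1, norm_one] at h2
  exact lt_irrefl _ h2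

lemma qPoch_ne_zero {q : ℂ} (hq : ‖q‖ < 1) (n : ℕ) : qPoch q n ≠ 0 :=
  Finset.prod_ne_zero_iff.mpr fun i _ ↦ one_sub_pow_ne_zero hq i

/-- The infinite product `∏_{n ≥ 1} (1 - qⁿ)`. -/
def eulerProd (q : ℂ) : ℂ := ∏' n : ℕ, (1 - q ^ (n + 1))

lemma tendsto_qPoch {q : ℂ} (hq : ‖q‖ < 1) : Tendsto (qPoch q) atTop (𝓝 (eulerProd q)) :=
  (ModularForm.multipliable_one_sub_pow hq).hasProd.tendsto_prod_nat

lemma summable_norm_pow_succ {q : ℂ} (hq : ‖q‖ < 1) : Summable fun n : ℕ ↦ ‖q ^ (n + 1)‖ := by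
  simpa using (summable_nat_add_iff 1).mpr (summable_geometric_of_lt_one (norm_nonneg _) hq)

lemma eulerProd_ne_zero {q : ℂ} (hq : ‖q‖ < 1) : eulerProd q ≠ 0 := by
  refine tprod_one_add_ne_zero_of_summable (f := fun n : ℕ ↦ -q ^ (n + 1)) ?_ ?_
  · intro n
    simpa [sub_eq_add_neg] using one_sub_pow_ne_zero hq n
  · simpa using summable_norm_pow_succ hq

/-- The coefficients are quotients of partial Euler products, which converge to a non-zero limit and
so are bounded above and away from 0. The uniform bound feeds dominated convergence. -/
lemma tripleCoeff_bounded {q : ℂ} (hq : ‖q‖ < 1) :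
    ∃ C : ℝ, ∀ N n, ‖tripleCoeff q N n‖ ≤ C := by
  obtain ⟨A, hA⟩ := (tendsto_qPoch hq).norm.bddAbove_range
  obtain ⟨B, hB⟩ := ((tendsto_qPoch hq).inv₀ (eulerProd_ne_zero hq)).norm.bddAbove_range
  have hA' : ∀ n, ‖qPoch q n‖ ≤ A := fun n ↦ hA ⟨n, rfl⟩
  have hB' : ∀ n, ‖(qPoch q n)⁻¹‖ ≤ B := fun n ↦ hB ⟨n, rfl⟩
  have hA0 : 0 ≤ A := (norm_nonneg _).trans (hA' 0)
  have hB0 : 0 ≤ B := (norm_nonneg _).trans (hB' 0)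
  refine ⟨A * B * B, fun N n ↦ ?_⟩
  by_cases h : -(N : ℤ) ≤ n ∧ n ≤ N
  · have h1 := tripleCoeff_mul_qPoch q h.1 h.2
    have h2 : tripleCoeff q N n =
        qPoch q (2 * N) * (qPoch q (N + n).toNat)⁻¹ * (qPoch q (N - n).toNat)⁻¹ := by
      rw [← h1]
      field_simp [qPoch_ne_zero hq]
    rw [h2, norm_mul, norm_mul]
    gcongr <;> simp only [hA', hB']
  · rw [tripleCoeff_eq_zero q h, norm_zero]
    positivity

lemma tendsto_tripleCoeff {q : ℂ} (hq : ‖q‖ < 1) (n : ℤ) :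
    Tendsto (fun N ↦ tripleCoeff q N n) atTop (𝓝 (eulerProd q)⁻¹) := by
  have hE := eulerProd_ne_zero hq
  have hP := tendsto_qPoch hq
  have t0 : Tendsto (fun N : ℕ ↦ 2 * N) atTop atTop :=
    tendsto_atTop_mono (fun N ↦ by simp only [id]; omega) tendsto_id
  have t1 : Tendsto (fun N : ℕ ↦ ((N : ℤ) + n).toNat) atTop atTop :=
    tendsto_atTop.mpr fun b ↦ by
      filter_upwards [eventually_ge_atTop (b + n.natAbs)] with N hN
      omega
  have t2 : Tendsto (fun N : ℕ ↦ ((N : ℤ) - n).toNat) atTop atTop :=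
    tendsto_atTop.mpr fun b ↦ by
      filter_upwards [eventually_ge_atTop (b + n.natAbs)] with N hN
      omega
  have lim := ((hP.comp t0).mul ((hP.comp t1).inv₀ hE)).mul ((hP.comp t2).inv₀ hE)
  rw [mul_inv_cancel₀ hE, one_mul] at lim
  refine lim.congr' ?_
  filter_upwards [eventually_ge_atTop n.natAbs] with N hN
  have h1 := tripleCoeff_mul_qPoch q (N := N) (n := n) (by omega) (by omega)
  simp only [Function.comp_apply]
  rw [← h1]
  field_simp [qPoch_ne_zero hq]

lemma multipliable_triple {Q : ℂ} (hQ : ‖Q‖ < 1) (x : ℂ) :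
    Multipliable fun i : ℕ ↦ (1 - x * Q ^ (2 * i)) * (1 - Q ^ (2 * (i + 1)) / x) := by
  have hQ2 : ‖Q‖ ^ 2 < 1 := pow_lt_one₀ (norm_nonneg _) hQ two_ne_zero
  have hs := summable_geometric_of_lt_one (by positivity) hQ2
  refine Multipliable.mul ?_ ?_
  · simp_rw [sub_eq_add_neg]
    refine multipliable_one_add_of_summable ?_
    simpa [pow_mul] using hs.mul_left ‖x‖
  · simp_rw [sub_eq_add_neg]
    refine multipliable_one_add_of_summable ?_
    simpa [pow_mul] using ((summable_nat_add_iff 1).mpr hs).div_const ‖x‖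

/-- Jacobi's triple product identity. -/
theorem jacobi_triple_product {Q x : ℂ} (hQ0 : Q ≠ 0) (hQ : ‖Q‖ < 1) (hx : x ≠ 0)
    (hs : Summable fun n : ℤ ↦ ‖(-x) ^ n * Q ^ (n * (n - 1))‖) :
    ∏' i : ℕ, ((1 - x * Q ^ (2 * i)) * (1 - Q ^ (2 * (i + 1)) / x)) =
      (eulerProd (Q ^ 2))⁻¹ * ∑' n : ℤ, (-x) ^ n * Q ^ (n * (n - 1)) := by
  have hq : ‖Q ^ 2‖ < 1 := by
    rw [norm_pow]; exact pow_lt_one₀ (norm_nonneg _) hQ two_ne_zero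
  obtain ⟨C, hC⟩ := tripleCoeff_bounded hq
  have l1 := (multipliable_triple hQ x).hasProd.tendsto_prod_nat
  -- Let `N → ∞` in the finite identity, termwise on the series side.
  have l2 := tendsto_tsum_of_dominated_convergence (𝓕 := atTop)
    (f := fun N n ↦ tripleCoeff (Q ^ 2) N n * ((-x) ^ n * Q ^ (n * (n - 1))))
    (g := fun n ↦ (eulerProd (Q ^ 2))⁻¹ * ((-x) ^ n * Q ^ (n * (n - 1)))) (hs.mul_left C)
    (fun n ↦ (tendsto_tripleCoeff hq n).mul_const _)
    (Eventually.of_forall fun N n ↦ by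
      rw [norm_mul]
      exact mul_le_mul_of_nonneg_right (hC N n) (norm_nonneg _))
  rw [tsum_mul_left] at l2
  refine tendsto_nhds_unique l1 (l2.congr fun N ↦ ?_)
  rw [finite_triple_product hQ0 hx,
    ← sum_gaussBinom_eq_tsum (Q ^ 2) N fun n ↦ (-x) ^ n * Q ^ (n * (n - 1))]

/-! ### Siegel functions as theta functions -/

lemma norm_qTau_lt_one (τ : ℍ) : ‖qTau τ‖ < 1 := by
  have h := UpperHalfPlane.norm_exp_two_pi_I_lt_one τ
  simpa [qTau] using h

lemma qZ_ne_zero (a₁ a₂ : ℚ) (τ : ℍ) : qZ a₁ a₂ τ ≠ 0 := Complex.exp_ne_zero _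

lemma summable_qTau_mul (x : ℂ) (τ : ℍ) : Summable fun n : ℕ ↦ ‖-(qTau τ ^ (n + 1) * x)‖ := by
  simpa [pow_succ] using (summable_norm_pow_succ (norm_qTau_lt_one τ)).mul_right ‖x‖

lemma summable_qTau_div (x : ℂ) (τ : ℍ) : Summable fun n : ℕ ↦ ‖-(qTau τ ^ (n + 1) / x)‖ := by
  simpa only [div_eq_mul_inv] using summable_qTau_mul x⁻¹ τ

lemma tprod_siegel_eq (x : ℂ) (τ : ℍ) :
    ∏' n : ℕ, ((1 - qTau τ ^ (n + 1) * x) * (1 - qTau τ ^ (n + 1) / x)) =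
      (∏' n : ℕ, (1 + -(qTau τ ^ (n + 1) * x))) * ∏' n : ℕ, (1 + -(qTau τ ^ (n + 1) / x)) := by
  simp_rw [sub_eq_add_neg]
  exact (multipliable_one_add_of_summable (summable_qTau_mul x τ)).tprod_mul
    (multipliable_one_add_of_summable (summable_qTau_div x τ))

/-- The separate factor `1 - x` is the missing term of index 0, which gives the shape of the triple
product. -/
lemma one_sub_mul_tprod (x : ℂ) (τ : ℍ) :
    (1 - x) * ∏' n : ℕ, ((1 - qTau τ ^ (n + 1) * x) * (1 - qTau τ ^ (n + 1) / x)) =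
      ∏' i : ℕ, ((1 - x * qTau τ ^ i) * (1 - qTau τ ^ (i + 1) / x)) := by
  have hs : Summable fun i : ℕ ↦ ‖-(x * qTau τ ^ i)‖ := by
    refine (summable_nat_add_iff 1).mp ?_
    simpa [mul_comm] using summable_qTau_mul x τ
  have h1 := multipliable_one_add_of_summable hs
  have h2 := multipliable_one_add_of_summable (summable_qTau_div x τ)
  have h3 := multipliable_one_add_of_summable (summable_qTau_mul x τ)
  rw [tprod_siegel_eq]
  simp_rw [sub_eq_add_neg]
  rw [h1.tprod_mul h2, tprod_eq_zero_mul' (f := fun i : ℕ ↦ 1 + -(x * qTau τ ^ i))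
    (by simpa only [mul_comm] using h3)]
  simp only [pow_zero, one_mul, mul_assoc, mul_comm x]

lemma one_sub_mul_tprod_eq_theta (a₁ a₂ : ℚ) (τ : ℍ) :
    (1 - qZ a₁ a₂ τ) * ∏' n : ℕ, ((1 - qTau τ ^ (n + 1) * qZ a₁ a₂ τ) *
        (1 - qTau τ ^ (n + 1) / qZ a₁ a₂ τ)) =
      (eulerProd (qTau τ))⁻¹ * jacobiTheta₂ (a₁ * τ + a₂ + 1 / 2 - τ / 2) τ := by
  set Q : ℂ := Complex.exp (π * Complex.I * τ) with hQ
  have hq : qTau τ = Q ^ 2 := by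
    rw [qTau, hQ, ← Complex.exp_nat_mul]
    push_cast; ring_nf
  have hQ1 : ‖Q‖ < 1 := by
    have h := norm_qTau_lt_one τ
    rw [hq, norm_pow] at h
    exact lt_of_pow_lt_pow_left₀ 2 zero_le_one (by simpa using h)
  -- The sign in `-q_z` accounts for the shift `1/2` of the theta argument, and `Q^{-n}` for the
  -- shift `-τ/2`.
  have hterm : ∀ n : ℤ, (-qZ a₁ a₂ τ) ^ n * Q ^ (n * (n - 1)) =
      jacobiTheta₂_term n (a₁ * τ + a₂ + 1 / 2 - τ / 2) τ := by
    intro n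
    have h1 : -qZ a₁ a₂ τ =
        Complex.exp (2 * π * Complex.I * (a₁ * τ + a₂) + π * Complex.I) := by
      rw [Complex.exp_add, Complex.exp_pi_mul_I, qZ]; ring
    rw [h1, hQ, ← Complex.exp_int_mul, ← Complex.exp_int_mul, ← Complex.exp_add, jacobiTheta₂_term]
    congr 1
    push_cast
    ring
  have hsum : Summable fun n : ℤ ↦ ‖(-qZ a₁ a₂ τ) ^ n * Q ^ (n * (n - 1))‖ := by
    simp_rw [hterm]
    exact ((summable_jacobiTheta₂_term_iff _ _).mpr τ.im_pos).norm
  have key := jacobi_triple_product (show Q ≠ 0 from Complex.exp_ne_zero _) hQ1 (qZ_ne_zero a₁ a₂ τ) hsum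
  rw [one_sub_mul_tprod, hq]
  simp_rw [← pow_mul]
  rw [key]
  simp_rw [hterm]
  rfl

lemma eta_eq (τ : ℍ) :
    ModularForm.eta τ = Complex.exp (2 * π * Complex.I * τ / 24) * eulerProd (qTau τ) := by
  rw [ModularForm.eta, eulerProd, qTau]
  simp only [ModularForm.eta_q, Function.Periodic.qParam]
  norm_num

/-- The Siegel function in terms of Jacobi's theta function and Dedekind's eta function, as a
function of a complex variable. -/
def siegelTheta (a₁ a₂ : ℚ) (z : ℂ) : ℂ :=
  -Complex.exp (π * Complex.I * (a₂ * (a₁ - 1) + (a₁ - 1 / 2) ^ 2 * z)) *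
    jacobiTheta₂ (a₁ * z + a₂ + 1 / 2 - z / 2) z / ModularForm.eta z

/-- The exponents match because `B₂(a₁)/2 + 1/24 = (a₁ - 1/2)²/2`, where `1/24` comes from eta. -/
lemma siegel_eq_siegelTheta (a₁ a₂ : ℚ) (τ : ℍ) : siegel a₁ a₂ τ = siegelTheta a₁ a₂ τ := by
  rw [siegel, mul_assoc, one_sub_mul_tprod_eq_theta, siegelTheta, eta_eq]
  have hE := eulerProd_ne_zero (norm_qTau_lt_one τ)
  have h : Complex.exp (2 * π * Complex.I * ((a₂ : ℂ) * ((a₁ : ℂ) - 1) / 2)) *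
      Complex.exp (2 * π * Complex.I * ((B2 a₁ : ℂ) / 2) * (τ : ℂ)) *
      Complex.exp (2 * π * Complex.I * τ / 24) =
      Complex.exp (π * Complex.I * (a₂ * (a₁ - 1) + (a₁ - 1 / 2) ^ 2 * τ)) := by
    rw [← Complex.exp_add, ← Complex.exp_add, B2]
    congr 1
    push_cast
    ring
  rw [← h]
  have := Complex.exp_ne_zero (2 * π * Complex.I * τ / 24)
  field_simp

lemma differentiableAt_siegelTheta (a₁ a₂ : ℚ) {z : ℂ} (hz : 0 < z.im) :
    DifferentiableAt ℂ (siegelTheta a₁ a₂) z := by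
  have h1 : DifferentiableAt ℂ
      (fun w : ℂ ↦ jacobiTheta₂ (a₁ * w + a₂ + 1 / 2 - w / 2) w) z :=
    DifferentiableAt.comp (g := fun p : ℂ × ℂ ↦ jacobiTheta₂ p.1 p.2)
      (f := fun w : ℂ ↦ ((a₁ * w + a₂ + 1 / 2 - w / 2 : ℂ), w)) z
      (hasFDerivAt_jacobiTheta₂ _ hz).differentiableAt (by fun_prop)
  have h2 := ModularForm.differentiableAt_eta_of_mem_upperHalfPlaneSet (z := z) hz
  unfold siegelTheta
  exact DifferentiableAt.div (DifferentiableAt.mul (by fun_prop) h1) h2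
    (ModularForm.eta_ne_zero hz)

lemma mdifferentiable_siegel (a₁ a₂ : ℚ) : MDifferentiable 𝓘(ℂ) 𝓘(ℂ) (siegel a₁ a₂) := by
  rw [UpperHalfPlane.mdifferentiable_iff]
  have h : DifferentiableOn ℂ (siegelTheta a₁ a₂) {z | 0 < z.im} := fun z hz ↦
    (differentiableAt_siegelTheta a₁ a₂ hz).differentiableWithinAt
  refine h.congr fun z hz ↦ ?_
  rw [Function.comp_apply, siegel_eq_siegelTheta, UpperHalfPlane.ofComplex_apply_of_im_pos hz]

/-- If the exponential were 1, imaginary parts would force `a₁ = -k`, and then `a₂` would be an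
integer. This excludes zeros of every factor of the Siegel product. -/
lemma exp_ne_one_of_not_int {a₁ a₂ : ℚ} (h : ¬∃ m n : ℤ, a₁ = m ∧ a₂ = n) (k : ℤ) (τ : ℍ) :
    Complex.exp (2 * π * Complex.I * ((a₁ + k) * τ + a₂)) ≠ 1 := by
  intro he
  obtain ⟨n, hn⟩ := Complex.exp_eq_one_iff.mp he
  have hpi : (2 * π * Complex.I : ℂ) ≠ 0 := Complex.two_pi_I_ne_zero
  have h1 : ((a₁ : ℂ) + k) * τ + a₂ = n := by
    apply mul_left_cancel₀ hpi
    rw [hn]; ring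
  have him := congrArg Complex.im h1
  have e1 : ((a₁ : ℂ) + k) = (((a₁ + k : ℚ) : ℝ) : ℂ) := by push_cast; rfl
  have e2 : (a₂ : ℂ) = ((a₂ : ℝ) : ℂ) := by push_cast; rfl
  rw [e1, e2, Complex.add_im, Complex.im_ofReal_mul, Complex.ofReal_im, Complex.intCast_im,
    add_zero] at him
  have h2 : (a₁ + k : ℚ) = 0 := by
    rcases mul_eq_zero.mp him with h3 | h3
    · exact_mod_cast h3
    · exact absurd h3 τ.im_ne_zero
  rw [e1, h2] at h1
  refine h ⟨-k, n, by push_cast; linarith, ?_⟩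
  simp only [Rat.cast_zero, Complex.ofReal_zero, zero_mul, zero_add] at h1
  exact_mod_cast h1

lemma siegel_ne_zero {a₁ a₂ : ℚ} (h : ¬∃ m n : ℤ, a₁ = m ∧ a₂ = n) (τ : ℍ) :
    siegel a₁ a₂ τ ≠ 0 := by
  have hx := qZ_ne_zero a₁ a₂ τ
  have hpow : ∀ n : ℕ, qTau τ ^ (n + 1) * qZ a₁ a₂ τ =
      Complex.exp (2 * π * Complex.I * ((a₁ + (n + 1 : ℤ)) * τ + a₂)) := by
    intro n
    rw [qTau, qZ, ← Complex.exp_nat_mul, ← Complex.exp_add]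
    congr 1; push_cast; ring
  have hpow' : ∀ n : ℕ, qZ a₁ a₂ τ / qTau τ ^ (n + 1) =
      Complex.exp (2 * π * Complex.I * ((a₁ + (-(n + 1) : ℤ)) * τ + a₂)) := by
    intro n
    rw [qTau, qZ, ← Complex.exp_nat_mul, ← Complex.exp_sub]
    congr 1; push_cast; ring
  rw [siegel, tprod_siegel_eq]
  refine mul_ne_zero (mul_ne_zero (mul_ne_zero (neg_ne_zero.mpr (Complex.exp_ne_zero _))
    (Complex.exp_ne_zero _)) ?_) (mul_ne_zero ?_ ?_)
  · rw [sub_ne_zero]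
    have := exp_ne_one_of_not_int h 0 τ
    simpa [qZ] using this.symm
  · refine tprod_one_add_ne_zero_of_summable (fun n ↦ ?_) (summable_qTau_mul _ τ)
    rw [← sub_eq_add_neg, sub_ne_zero, hpow]
    exact (exp_ne_one_of_not_int h _ τ).symm
  · refine tprod_one_add_ne_zero_of_summable (fun n ↦ ?_) (summable_qTau_div _ τ)
    rw [← sub_eq_add_neg, sub_ne_zero]
    intro h1
    refine exp_ne_one_of_not_int h (-(n + 1)) τ ?_
    have hq : qTau τ ^ (n + 1) ≠ 0 := pow_ne_zero _ (Complex.exp_ne_zero _)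
    rw [eq_div_iff hx, one_mul] at h1
    rw [← hpow', div_eq_one_iff_eq hq, h1]

/-! ### Transformation laws of Siegel functions -/

lemma siegel_add_one_right (a₁ a₂ : ℚ) (τ : ℍ) :
    siegel a₁ (a₂ + 1) τ = -Complex.exp (π * Complex.I * a₁) * siegel a₁ a₂ τ := by
  have h : qZ a₁ (a₂ + 1) τ = qZ a₁ a₂ τ := by
    rw [qZ, qZ, ← Complex.exp_periodic (2 * π * Complex.I * (a₁ * τ + a₂))]
    congr 1; push_cast; ring
  have h2 : Complex.exp (2 * π * Complex.I * (((a₂ + 1 : ℚ) : ℂ) * ((a₁ : ℂ) - 1) / 2)) =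
      -Complex.exp (π * Complex.I * a₁) *
        Complex.exp (2 * π * Complex.I * ((a₂ : ℂ) * ((a₁ : ℂ) - 1) / 2)) := by
    rw [neg_eq_neg_one_mul, ← Complex.exp_neg_pi_mul_I, ← Complex.exp_add, ← Complex.exp_add]
    congr 1; push_cast; ring
  rw [siegel, siegel, h, h2]
  ring

lemma siegel_add_one_left (a₁ a₂ : ℚ) (τ : ℍ) :
    siegel (a₁ + 1) a₂ τ = -Complex.exp (-π * Complex.I * a₂) * siegel a₁ a₂ τ := by
  rw [siegel_eq_siegelTheta, siegel_eq_siegelTheta, siegelTheta, siegelTheta]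
  have h1 : (((a₁ + 1 : ℚ) : ℂ) * τ + a₂ + 1 / 2 - τ / 2 : ℂ) =
      (a₁ * τ + a₂ + 1 / 2 - τ / 2) + τ := by push_cast; ring
  rw [h1, jacobiTheta₂_add_left', neg_eq_neg_one_mul (Complex.exp (-π * Complex.I * a₂)),
    ← Complex.exp_neg_pi_mul_I, ← Complex.exp_add]
  have h2 : Complex.exp (π * Complex.I * (a₂ * (((a₁ + 1 : ℚ) : ℂ) - 1) +
        (((a₁ + 1 : ℚ) : ℂ) - 1 / 2) ^ 2 * τ)) *
      Complex.exp (-π * Complex.I * (τ + 2 * (a₁ * τ + a₂ + 1 / 2 - τ / 2))) =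
      Complex.exp (-(π * Complex.I) + -π * Complex.I * a₂) *
        Complex.exp (π * Complex.I * (a₂ * (a₁ - 1) + (a₁ - 1 / 2) ^ 2 * τ)) := by
    rw [← Complex.exp_add, ← Complex.exp_add]
    congr 1; push_cast; ring
  linear_combination (-jacobiTheta₂ (a₁ * τ + a₂ + 1 / 2 - τ / 2) τ / ModularForm.eta τ) * h2

lemma siegel_T_smul (a₁ a₂ : ℚ) (τ : ℍ) :
    siegel a₁ a₂ (ModularGroup.T • τ) =
      Complex.exp (2 * π * Complex.I / 12) * siegel a₁ (a₁ + a₂) τ := by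
  have hc : ((ModularGroup.T • τ : ℍ) : ℂ) = τ + 1 := by
    rw [UpperHalfPlane.modular_T_smul, UpperHalfPlane.coe_vadd]
    push_cast; ring
  have h1 : qTau (ModularGroup.T • τ) = qTau τ := by
    rw [qTau, qTau, hc, ← Complex.exp_periodic (2 * π * Complex.I * τ)]
    congr 1; ring
  have h2 : qZ a₁ a₂ (ModularGroup.T • τ) = qZ a₁ (a₁ + a₂) τ := by
    rw [qZ, qZ, hc]
    congr 1; push_cast; ring
  have h3 : Complex.exp (2 * π * Complex.I * ((a₂ : ℂ) * ((a₁ : ℂ) - 1) / 2)) *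
      Complex.exp (2 * π * Complex.I * ((B2 a₁ : ℂ) / 2) * (τ + 1)) =
      Complex.exp (2 * π * Complex.I / 12) *
        (Complex.exp (2 * π * Complex.I * (((a₁ + a₂ : ℚ) : ℂ) * ((a₁ : ℂ) - 1) / 2)) *
          Complex.exp (2 * π * Complex.I * ((B2 a₁ : ℂ) / 2) * τ)) := by
    rw [← Complex.exp_add, ← Complex.exp_add, ← Complex.exp_add, B2]
    congr 1; push_cast; ring
  rw [siegel, siegel, h1, h2, hc]
  linear_combination (-(1 - qZ a₁ (a₁ + a₂) τ) * ∏' n : ℕ,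
    ((1 - qTau τ ^ (n + 1) * qZ a₁ (a₁ + a₂) τ) * (1 - qTau τ ^ (n + 1) / qZ a₁ (a₁ + a₂) τ))) * h3

/-- For `τ` in the upper half plane the logarithm splits on `-iτ` without crossing the branch cut.
In this form the root is the one in the theta functional equation, and the two cancel. -/
lemma eta_neg_one_div (τ : ℍ) :
    ModularForm.eta (-1 / (τ : ℂ)) =
      (-Complex.I * τ) ^ (1 / 2 : ℂ) * ModularForm.eta τ := by
  have h := ModularForm.eta_comp_eq_csqrt_I_inv τ.im_pos
  simp only [Function.comp_apply, Pi.smul_apply, Pi.mul_apply, smul_eq_mul] at h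
  rw [h, ← mul_assoc]
  congr 1
  have harg : Complex.log (-Complex.I * τ) = Complex.log (-Complex.I) + Complex.log τ := by
    rw [Complex.log_mul_eq_add_log_iff (by simp) τ.ne_zero, Complex.arg_neg_I]
    have h1 : 0 < Complex.arg τ := by
      refine lt_of_le_of_ne (Complex.arg_nonneg_iff.mpr τ.im_pos.le) fun h0 ↦ ?_
      exact τ.im_ne_zero (Complex.arg_eq_zero_iff.mp h0.symm).2
    have h2 := Complex.arg_le_pi τ
    constructor <;> linarith [Real.pi_pos]
  rw [Complex.sqrt, Complex.sqrt, Complex.cpow_def_of_ne_zero Complex.I_ne_zero,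
    Complex.cpow_def_of_ne_zero τ.ne_zero,
    Complex.cpow_def_of_ne_zero (mul_ne_zero (by simp) τ.ne_zero), harg, Complex.log_I,
    Complex.log_neg_I, ← Complex.exp_neg, ← Complex.exp_add]
  congr 1
  ring

lemma siegel_S_smul (a₁ a₂ : ℚ) (τ : ℍ) :
    siegel a₁ a₂ (ModularGroup.S • τ) = -Complex.I * siegel a₂ (-a₁) τ := by
  have hτ := τ.ne_zero
  have hc : ((ModularGroup.S • τ : ℍ) : ℂ) = -1 / τ := by
    rw [UpperHalfPlane.modular_S_smul, UpperHalfPlane.coe_mk, neg_div, one_div, inv_neg]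
  set Z : ℂ := a₂ * τ + (-a₁ : ℚ) + 1 / 2 - τ / 2 with hZ
  have hR : (-Complex.I * τ : ℂ) ^ (1 / 2 : ℂ) ≠ 0 := by
    rw [Complex.cpow_def_of_ne_zero (mul_ne_zero (by simp) hτ)]
    exact Complex.exp_ne_zero _
  -- The theta argument at `-1/τ` is `(Z + τ)/τ`; quasi-periodicity then removes the extra `τ`.
  have hf := jacobiTheta₂_functional_equation (Z + τ) τ
  have hη' := eta_neg_one_div τ
  generalize (-Complex.I * τ : ℂ) ^ (1 / 2 : ℂ) = R at hf hR hη'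
  rw [jacobiTheta₂_add_left'] at hf
  have hZ' : (a₁ * (-1 / (τ : ℂ)) + a₂ + 1 / 2 - (-1 / (τ : ℂ)) / 2) = (Z + τ) / τ := by
    rw [hZ]; push_cast; field_simp; ring
  have hθ : jacobiTheta₂ ((Z + τ) / τ) (-1 / τ) = R *
      Complex.exp (π * Complex.I * (Z + τ) ^ 2 / τ + -π * Complex.I * (τ + 2 * Z)) *
      jacobiTheta₂ Z τ := by
    rw [Complex.exp_add, mul_assoc, mul_assoc, hf]
    have h1 : Complex.exp (π * Complex.I * (Z + τ) ^ 2 / τ) *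
        Complex.exp (-π * Complex.I * (Z + τ) ^ 2 / τ) = 1 := by
      rw [← Complex.exp_add, ← Complex.exp_zero]
      congr 1; ring
    rw [one_div]
    linear_combination (-jacobiTheta₂ ((Z + τ) / τ) (-1 / τ)) * h1 +
      (-jacobiTheta₂ ((Z + τ) / τ) (-1 / τ) * Complex.exp (π * Complex.I * (Z + τ) ^ 2 / τ) *
        Complex.exp (-π * Complex.I * (Z + τ) ^ 2 / τ)) * mul_inv_cancel₀ hR
  rw [siegel_eq_siegelTheta, siegel_eq_siegelTheta, siegelTheta, siegelTheta, hc, hη',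
    hZ', hθ, ← hZ, ← Complex.exp_neg_pi_div_two_mul_I]
  have hη := ModularForm.eta_ne_zero τ.im_pos
  have h2 : Complex.exp (π * Complex.I * (a₂ * (a₁ - 1) + (a₁ - 1 / 2) ^ 2 * (-1 / τ))) *
      Complex.exp (π * Complex.I * (Z + τ) ^ 2 / τ + -π * Complex.I * (τ + 2 * Z)) =
      Complex.exp (-π / 2 * Complex.I) * Complex.exp (π * Complex.I *
        ((-a₁ : ℚ) * (a₂ - 1) + (a₂ - 1 / 2) ^ 2 * τ)) := by
    rw [← Complex.exp_add, ← Complex.exp_add, hZ]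
    congr 1
    push_cast
    field_simp
    ring
  rw [div_eq_iff (mul_ne_zero hR hη)]
  set H := ModularForm.eta τ
  have h3 := mul_inv_cancel₀ hη
  simp only [div_eq_mul_inv _ H]
  linear_combination (-jacobiTheta₂ Z τ * R) * h2 +
    (Complex.exp (-π / 2 * Complex.I) * Complex.exp (π * Complex.I *
        ((-a₁ : ℚ) * (a₂ - 1) + (a₂ - 1 / 2) ^ 2 * τ)) * jacobiTheta₂ Z τ * R) * h3

/-- Siegel functions transform under `SL(2, ℤ)` by the right action on the index, up to a
twelfth root of unity that does not depend on the index. -/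
theorem exists_siegel_smul (γ : SL(2, ℤ)) :
    ∃ k : ℂ, k ^ 12 = 1 ∧ ∀ (a₁ a₂ : ℚ) (τ : ℍ), siegel a₁ a₂ (γ • τ) =
      k * siegel (a₁ * γ 0 0 + a₂ * γ 1 0) (a₁ * γ 0 1 + a₂ * γ 1 1) τ := by
  have hγ : γ ∈ Subgroup.closure {ModularGroup.S, ModularGroup.T} := by
    simp [SpecialLinearGroup.SL2Z_generators]
  induction hγ using Subgroup.closure_induction with
  | mem γ hγ =>
    rcases hγ with rfl | rfl
    · refine ⟨-Complex.I, ?_, fun a₁ a₂ τ ↦ ?_⟩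
      · rw [show (-Complex.I) ^ 12 = (Complex.I ^ 2) ^ 6 by ring, Complex.I_sq]; norm_num
      · rw [siegel_S_smul]
        simp [ModularGroup.S]
    · refine ⟨Complex.exp (2 * π * Complex.I / 12), ?_, fun a₁ a₂ τ ↦ ?_⟩
      · rw [← Complex.exp_nat_mul, ← Complex.exp_two_pi_mul_I]
        congr 1; push_cast; ring
      · rw [siegel_T_smul]
        simp [ModularGroup.T]
  | one => exact ⟨1, one_pow _, fun a₁ a₂ τ ↦ by simp⟩
  | mul γ δ _ _ ihγ ihδ =>
    obtain ⟨k, hk, h⟩ := ihγ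
    obtain ⟨l, hl, h'⟩ := ihδ
    refine ⟨k * l, by rw [mul_pow, hk, hl, one_mul], fun a₁ a₂ τ ↦ ?_⟩
    rw [mul_smul, h, h', ← mul_assoc]
    simp only [Matrix.SpecialLinearGroup.coe_mul, Matrix.mul_apply, Fin.sum_univ_two]
    push_cast
    congr 2 <;> ring
  | inv γ _ ih =>
    obtain ⟨k, hk, h⟩ := ih
    have hk0 : k ≠ 0 := by rintro rfl; norm_num at hk
    refine ⟨k⁻¹, by rw [inv_pow, hk, inv_one], fun a₁ a₂ τ ↦ ?_⟩
    have hdet : (γ 0 0 : ℚ) * γ 1 1 - γ 0 1 * γ 1 0 = 1 := by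
      have := γ.det_coe
      rw [Matrix.det_fin_two] at this
      exact_mod_cast this
    have := h (a₁ * γ⁻¹ 0 0 + a₂ * γ⁻¹ 1 0) (a₁ * γ⁻¹ 0 1 + a₂ * γ⁻¹ 1 1) (γ⁻¹ • τ)
    rw [smul_inv_smul] at this
    rw [this, inv_mul_cancel_left₀ hk0]
    rw [Matrix.SpecialLinearGroup.SL2_inv_expl]
    simp only [Matrix.cons_val', Matrix.cons_val_zero, Matrix.cons_val_one,
      Matrix.cons_val_fin_one]
    push_cast
    congr 1
    · linear_combination (-a₁) * hdet
    · linear_combination (-a₂) * hdet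

/-! ### Integral translations of the index -/

/-- Even translations are singled out because the minus signs of the unit translations cancel in
pairs. -/
lemma siegel_add_two_mul_right (a₁ a₂ : ℚ) (n : ℤ) (τ : ℍ) :
    siegel a₁ (a₂ + 2 * n) τ = Complex.exp (2 * π * Complex.I * (a₁ * n)) * siegel a₁ a₂ τ := by
  have step : ∀ b : ℚ, siegel a₁ (b + 2) τ =
      Complex.exp (2 * π * Complex.I * a₁) * siegel a₁ b τ := by
    intro b
    rw [show b + 2 = b + 1 + 1 by ring, siegel_add_one_right, siegel_add_one_right, ← mul_assoc,
      neg_mul_neg, ← Complex.exp_add]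
    ring_nf
  induction n using Int.induction_on with
  | zero => simp
  | succ n ih =>
    rw [show a₂ + 2 * ((n + 1 : ℤ) : ℚ) = a₂ + 2 * ((n : ℤ) : ℚ) + 2 by push_cast; ring, step, ih,
      ← mul_assoc, ← Complex.exp_add]
    congr 2; push_cast; ring
  | pred n ih =>
    have h := step (a₂ + 2 * ((-n - 1 : ℤ) : ℚ))
    rw [show a₂ + 2 * ((-n - 1 : ℤ) : ℚ) + 2 = a₂ + 2 * ((-n : ℤ) : ℚ) by push_cast; ring, ih] at h
    rw [← mul_right_inj' (Complex.exp_ne_zero (2 * π * Complex.I * a₁)), ← h,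
      ← mul_assoc (Complex.exp _) (Complex.exp _), ← Complex.exp_add]
    congr 2; push_cast; ring

lemma siegel_add_two_mul_left (a₁ a₂ : ℚ) (m : ℤ) (τ : ℍ) :
    siegel (a₁ + 2 * m) a₂ τ = Complex.exp (-(2 * π * Complex.I * (a₂ * m))) * siegel a₁ a₂ τ := by
  have step : ∀ b : ℚ, siegel (b + 2) a₂ τ =
      Complex.exp (-(2 * π * Complex.I * a₂)) * siegel b a₂ τ := by
    intro b
    rw [show b + 2 = b + 1 + 1 by ring, siegel_add_one_left, siegel_add_one_left, ← mul_assoc,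
      neg_mul_neg, ← Complex.exp_add]
    ring_nf
  induction m using Int.induction_on with
  | zero => simp
  | succ n ih =>
    rw [show a₁ + 2 * ((n + 1 : ℤ) : ℚ) = a₁ + 2 * ((n : ℤ) : ℚ) + 2 by push_cast; ring, step, ih,
      ← mul_assoc, ← Complex.exp_add]
    congr 2; push_cast; ring
  | pred n ih =>
    have h := step (a₁ + 2 * ((-n - 1 : ℤ) : ℚ))
    rw [show a₁ + 2 * ((-n - 1 : ℤ) : ℚ) + 2 = a₁ + 2 * ((-n : ℤ) : ℚ) by push_cast; ring, ih] at h
    rw [← mul_right_inj' (Complex.exp_ne_zero (-(2 * π * Complex.I * a₂))), ← h,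
      ← mul_assoc (Complex.exp _) (Complex.exp _), ← Complex.exp_add]
    congr 2; push_cast; ring

/-- Two functions agree up to a non-zero constant factor. -/
def EqUpToConst (f g : ℍ → ℂ) : Prop := ∃ c : ℂ, c ≠ 0 ∧ ∀ τ, f τ = c * g τ

lemma EqUpToConst.refl (f : ℍ → ℂ) : EqUpToConst f f := ⟨1, one_ne_zero, by simp⟩

lemma EqUpToConst.symm {f g : ℍ → ℂ} (h : EqUpToConst f g) : EqUpToConst g f := by
  obtain ⟨c, hc, h⟩ := h
  exact ⟨c⁻¹, inv_ne_zero hc, fun τ ↦ by rw [h, inv_mul_cancel_left₀ hc]⟩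

lemma EqUpToConst.trans {f g k : ℍ → ℂ} (h : EqUpToConst f g) (h' : EqUpToConst g k) :
    EqUpToConst f k := by
  obtain ⟨c, hc, h⟩ := h
  obtain ⟨d, hd, h'⟩ := h'
  exact ⟨c * d, mul_ne_zero hc hd, fun τ ↦ by rw [h, h', mul_assoc]⟩

lemma EqUpToConst.mul {f g f' g' : ℍ → ℂ} (h : EqUpToConst f g) (h' : EqUpToConst f' g') :
    EqUpToConst (fun τ ↦ f τ * f' τ) fun τ ↦ g τ * g' τ := by
  obtain ⟨c, hc, h⟩ := h
  obtain ⟨d, hd, h'⟩ := h'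
  exact ⟨c * d, mul_ne_zero hc hd, fun τ ↦ by simp only [h, h']; ring⟩

lemma EqUpToConst.prod {ι : Type*} (s : Finset ι) {f g : ι → ℍ → ℂ}
    (h : ∀ i ∈ s, EqUpToConst (f i) (g i)) :
    EqUpToConst (fun τ ↦ ∏ i ∈ s, f i τ) fun τ ↦ ∏ i ∈ s, g i τ := by
  classical
  induction s using Finset.induction_on with
  | empty => simpa using EqUpToConst.refl _
  | insert a s ha ih =>
    simp only [Finset.prod_insert ha]
    exact (h a (Finset.mem_insert_self a s)).mul
      (ih fun i hi ↦ h i (Finset.mem_insert_of_mem hi))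

lemma siegel_eqUpToConst_add_one_right (a₁ a₂ : ℚ) :
    EqUpToConst (siegel a₁ (a₂ + 1)) (siegel a₁ a₂) :=
  ⟨_, neg_ne_zero.mpr (Complex.exp_ne_zero _), siegel_add_one_right a₁ a₂⟩

lemma siegel_eqUpToConst_add_one_left (a₁ a₂ : ℚ) :
    EqUpToConst (siegel (a₁ + 1) a₂) (siegel a₁ a₂) :=
  ⟨_, neg_ne_zero.mpr (Complex.exp_ne_zero _), siegel_add_one_left a₁ a₂⟩

lemma siegel_eqUpToConst_add_left (a₁ a₂ : ℚ) (m : ℤ) :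
    EqUpToConst (siegel (a₁ + m) a₂) (siegel a₁ a₂) := by
  induction m using Int.induction_on with
  | zero => simpa using EqUpToConst.refl _
  | succ n ih =>
    rw [show a₁ + ((n + 1 : ℤ) : ℚ) = a₁ + ((n : ℤ) : ℚ) + 1 by push_cast; ring]
    exact (siegel_eqUpToConst_add_one_left _ _).trans ih
  | pred n ih =>
    have h := siegel_eqUpToConst_add_one_left (a₁ + ((-n - 1 : ℤ) : ℚ)) a₂
    rw [show a₁ + ((-n - 1 : ℤ) : ℚ) + 1 = a₁ + ((-n : ℤ) : ℚ) by push_cast; ring] at h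
    exact h.symm.trans ih

lemma siegel_eqUpToConst_add_right (a₁ a₂ : ℚ) (m : ℤ) :
    EqUpToConst (siegel a₁ (a₂ + m)) (siegel a₁ a₂) := by
  induction m using Int.induction_on with
  | zero => simpa using EqUpToConst.refl _
  | succ n ih =>
    rw [show a₂ + ((n + 1 : ℤ) : ℚ) = a₂ + ((n : ℤ) : ℚ) + 1 by push_cast; ring]
    exact (siegel_eqUpToConst_add_one_right _ _).trans ih
  | pred n ih =>
    have h := siegel_eqUpToConst_add_one_right a₁ (a₂ + ((-n - 1 : ℤ) : ℚ))
    rw [show a₂ + ((-n - 1 : ℤ) : ℚ) + 1 = a₂ + ((-n : ℤ) : ℚ) by push_cast; ring] at h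
    exact h.symm.trans ih

/-! ### Siegel functions of level `p` -/

/-- The Siegel function of index `(2v/p, 2w/p)`. -/
def levelSiegel (p : ℕ) (v w : ℤ) : ℍ → ℂ := siegel (2 * v / p) (2 * w / p)

/-- The primitive `p`-th root of unity `e^{2πi/p}`. -/
def zeta (p : ℕ) : ℂ := Complex.exp (2 * π * Complex.I / p)

lemma zeta_ne_zero (p : ℕ) : zeta p ≠ 0 := Complex.exp_ne_zero _

lemma isPrimitiveRoot_zeta (p : ℕ) [NeZero p] : IsPrimitiveRoot (zeta p) p :=
  Complex.isPrimitiveRoot_exp p (NeZero.ne p)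

lemma zeta_zpow_congr {p : ℕ} [NeZero p] {m n : ℤ} (h : (m : ZMod p) = n) :
    zeta p ^ m = zeta p ^ n := by
  have h1 : (p : ℤ) ∣ m - n := (ZMod.intCast_zmod_eq_zero_iff_dvd _ p).mp (by simp [h])
  have h2 := ((isPrimitiveRoot_zeta p).zpow_eq_one_iff_dvd (m - n)).mpr h1
  rw [zpow_sub₀ (zeta_ne_zero p)] at h2
  exact (div_eq_one_iff_eq (zpow_ne_zero _ (zeta_ne_zero p))).mp h2

lemma levelSiegel_add (p : ℕ) [NeZero p] (v w m n : ℤ) (τ : ℍ) :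
    levelSiegel p (v + p * m) (w + p * n) τ =
      zeta p ^ (2 * (n * v - m * w)) * levelSiegel p v w τ := by
  have hp : (p : ℚ) ≠ 0 := NeZero.ne _
  have hp' : (p : ℂ) ≠ 0 := NeZero.ne _
  have e1 : (2 * ((v + p * m : ℤ) : ℚ) / p) = 2 * v / p + 2 * m := by
    push_cast; field_simp
  have e2 : (2 * ((w + p * n : ℤ) : ℚ) / p) = 2 * w / p + 2 * n := by
    push_cast; field_simp
  have e4 : zeta p ^ (2 * (n * v - m * w)) =
      Complex.exp (2 * π * Complex.I * (((2 * v / p : ℚ) : ℂ) * n)) *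
        Complex.exp (-(2 * π * Complex.I * (((2 * w / p : ℚ) : ℂ) * m))) := by
    rw [zeta, ← Complex.exp_int_mul, ← Complex.exp_add]
    congr 1; push_cast; field_simp; ring
  rw [levelSiegel, levelSiegel, e1, e2, siegel_add_two_mul_left, siegel_add_two_mul_right,
    ← mul_assoc, e4]
  congr 1
  rw [mul_comm]
  congr 1
  -- The two translations interact only through the cross term `e^{-2πi·2mn} = 1`.
  rw [Complex.exp_eq_exp_iff_exists_int]
  refine ⟨-(2 * n * m), ?_⟩
  push_cast; field_simp; ring

/-- Passing to doubled indices costs a constant, which does not affect a transformation factor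
(`smul_of_eqUpToConst`). -/
lemma siegel_eqUpToConst_levelSiegel {p : ℕ} [NeZero p] {r s v w : ℤ}
    (hr : (r : ZMod p) = 2 * v) (hs : (s : ZMod p) = 2 * w) :
    EqUpToConst (siegel (r / p) (s / p)) (levelSiegel p v w) := by
  have hp : (p : ℚ) ≠ 0 := NeZero.ne _
  obtain ⟨m, hm⟩ := (ZMod.intCast_zmod_eq_zero_iff_dvd (r - 2 * v) p).mp (by simp [hr])
  obtain ⟨n, hn⟩ := (ZMod.intCast_zmod_eq_zero_iff_dvd (s - 2 * w) p).mp (by simp [hs])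
  have e1 : (r / p : ℚ) = 2 * v / p + m := by
    rw [show r = 2 * v + p * m by linarith]; push_cast; field_simp
  have e2 : (s / p : ℚ) = 2 * w / p + n := by
    rw [show s = 2 * w + p * n by linarith]; push_cast; field_simp
  rw [e1, e2]
  exact (siegel_eqUpToConst_add_left _ _ m).trans (siegel_eqUpToConst_add_right _ _ n)

/-- The product of the Siegel functions of index `(2u/p, 2x/p)` for `x` modulo `p`. -/
def levelProd (p : ℕ) [NeZero p] (u : ℤ) (τ : ℍ) : ℂ :=
  ∏ x : ZMod p, levelSiegel p u (x.val : ℤ) τ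

/-- An element of order `p - 1` generates the unit group, so 0 and the `β * α ^ j` exhaust `ZMod p`.
-/
lemma prod_zmod_eq_prod_pow {M : Type*} [CommMonoid M] {p : ℕ} [Fact p.Prime] {α β : ZMod p}
    (hα : orderOf α = p - 1) (hβ : β ≠ 0) (g : ZMod p → M) :
    ∏ x, g x = g 0 * ∏ j ∈ Finset.range (p - 1), g (β * α ^ j) := by
  classical
  have hp2 := (Fact.out : p.Prime).two_le
  have hα0 : α ≠ 0 := by
    rintro rfl
    have h := pow_orderOf_eq_one (0 : ZMod p)
    rw [hα, zero_pow (by omega)] at h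
    exact zero_ne_one h
  have hinj : Set.InjOn (fun j ↦ β * α ^ j) (Finset.range (p - 1) : Set ℕ) := by
    intro a ha b hb hab
    refine pow_injOn_Iio_orderOf (x := α) ?_ ?_ (mul_left_cancel₀ hβ hab)
    · simpa [hα] using ha
    · simpa [hα] using hb
  have hnot : (0 : ZMod p) ∉ (Finset.range (p - 1)).image fun j ↦ β * α ^ j := by
    simp [hβ, hα0]
  have huniv : insert 0 ((Finset.range (p - 1)).image fun j ↦ β * α ^ j) = Finset.univ := by
    refine Finset.eq_univ_of_card _ ?_
    rw [Finset.card_insert_of_notMem hnot, Finset.card_image_of_injOn hinj, Finset.card_range,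
      ZMod.card]
    omega
  rw [← huniv, Finset.prod_insert hnot, Finset.prod_image hinj]

lemma two_ne_zero_zmod {p : ℕ} [Fact p.Prime] (hp5 : 5 ≤ p) : (2 : ZMod p) ≠ 0 := by
  intro h
  have h2 : ((2 : ℕ) : ZMod p) = 0 := by exact_mod_cast h
  have := Nat.le_of_dvd two_pos ((ZMod.natCast_eq_zero_iff 2 p).mp h2)
  omega

lemma E_eqUpToConst {p : ℕ} [Fact p.Prime] (hp5 : 5 ≤ p) {α : ℤ}
    (hα : orderOf (α : ZMod p) = p - 1) {i : ℕ} {u : ℤ} (hu : (α : ZMod p) ^ i = 2 * u) :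
    EqUpToConst (E p α i) (levelProd p u) := by
  have h2 := two_ne_zero_zmod hp5
  have hu' : ((α ^ i : ℤ) : ZMod p) = 2 * u := by push_cast; exact hu
  have h0 : EqUpToConst (siegel ((α : ℚ) ^ i / p) 0)
      (levelSiegel p u ((0 : ZMod p).val : ℤ)) := by
    have := siegel_eqUpToConst_levelSiegel (p := p) (s := 0) (w := ((0 : ZMod p).val : ℤ)) hu'
      (by simp)
    simpa using this
  have h1 := EqUpToConst.prod (Finset.range (p - 1))
    (f := fun j ↦ siegel ((α : ℚ) ^ i / p) ((α : ℚ) ^ j / p))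
    (g := fun j ↦ levelSiegel p u (((2 : ZMod p)⁻¹ * (α : ZMod p) ^ j).val : ℤ)) fun j _ ↦ by
      have := siegel_eqUpToConst_levelSiegel (p := p) (s := α ^ j)
        (w := (((2 : ZMod p)⁻¹ * (α : ZMod p) ^ j).val : ℤ)) hu' (by
          rw [Int.cast_natCast, ZMod.natCast_zmod_val, mul_inv_cancel_left₀ h2]; push_cast; rfl)
      simpa using this
  have h3 := h0.mul h1
  have e : levelProd p u = fun τ ↦ levelSiegel p u ((0 : ZMod p).val : ℤ) τ *
      ∏ j ∈ Finset.range (p - 1),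
        levelSiegel p u (((2 : ZMod p)⁻¹ * (α : ZMod p) ^ j).val : ℤ) τ := by
    funext τ
    exact prod_zmod_eq_prod_pow hα (inv_ne_zero h2) fun x ↦ levelSiegel p u (x.val : ℤ) τ
  rw [e]
  exact h3

lemma F_eqUpToConst {p : ℕ} [NeZero p] {α : ℤ} {i : ℕ} {u : ℤ}
    (hu : (α : ZMod p) ^ i = 2 * u) : EqUpToConst (F p α i) (levelSiegel p 0 u) := by
  have hu' : ((α ^ i : ℤ) : ZMod p) = 2 * u := by push_cast; exact hu
  have := siegel_eqUpToConst_levelSiegel (p := p) (r := 0) (v := 0) (by simp) hu'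
  simp only [Int.cast_zero, zero_div, Int.cast_pow] at this
  exact this

lemma levelSiegel_smul (p : ℕ) {γ : SL(2, ℤ)} {k : ℂ}
    (hk : ∀ (a₁ a₂ : ℚ) (τ : ℍ), siegel a₁ a₂ (γ • τ) =
      k * siegel (a₁ * γ 0 0 + a₂ * γ 1 0) (a₁ * γ 0 1 + a₂ * γ 1 1) τ) (v w : ℤ) (τ : ℍ) :
    levelSiegel p v w (γ • τ) =
      k * levelSiegel p (v * γ 0 0 + w * γ 1 0) (v * γ 0 1 + w * γ 1 1) τ := by
  rw [levelSiegel, levelSiegel, hk]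
  congr 2 <;> (push_cast; ring)

lemma Gamma1_entries {p : ℕ} {γ : SL(2, ℤ)} (hγ : γ ∈ CongruenceSubgroup.Gamma1 p) :
    ∃ A C D : ℤ, γ 0 0 = 1 + p * A ∧ γ 1 0 = p * C ∧ γ 1 1 = 1 + p * D := by
  obtain ⟨h1, h2, h3⟩ := (CongruenceSubgroup.Gamma1_mem p γ).mp hγ
  obtain ⟨A, hA⟩ := (ZMod.intCast_zmod_eq_zero_iff_dvd (γ 0 0 - 1) p).mp (by simp [h1])
  obtain ⟨D, hD⟩ := (ZMod.intCast_zmod_eq_zero_iff_dvd (γ 1 1 - 1) p).mp (by simp [h2])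
  obtain ⟨C, hC⟩ := (ZMod.intCast_zmod_eq_zero_iff_dvd (γ 1 0) p).mp h3
  exact ⟨A, C, D, by linarith, hC, by linarith⟩

lemma prod_zpow_eq_zpow_sum {ι : Type*} {z : ℂ} (hz : z ≠ 0) (s : Finset ι) (g : ι → ℤ) :
    ∏ x ∈ s, z ^ g x = z ^ ∑ x ∈ s, g x := by
  classical
  induction s using Finset.induction_on with
  | empty => simp
  | insert a s ha ih =>
    rw [Finset.prod_insert ha, Finset.sum_insert ha, ih, zpow_add₀ hz]

lemma sum_zmod_eq_zero {p : ℕ} [Fact p.Prime] (hp5 : 5 ≤ p) : ∑ x : ZMod p, x = 0 := by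
  simpa using FiniteField.sum_pow_lt_card_sub_one (K := ZMod p) 1 (by rw [ZMod.card]; omega)

/-- Here `p ≥ 5` enters: the exponent 2 must be smaller than `p - 1`. -/
lemma sum_sq_zmod_eq_zero {p : ℕ} [Fact p.Prime] (hp5 : 5 ≤ p) : ∑ x : ZMod p, x ^ 2 = 0 :=
  FiniteField.sum_pow_lt_card_sub_one (K := ZMod p) 2 (by rw [ZMod.card]; omega)

lemma levelSiegel_zero_smul {p : ℕ} [NeZero p] {γ : SL(2, ℤ)} {k : ℂ}
    (hk : ∀ (a₁ a₂ : ℚ) (τ : ℍ), siegel a₁ a₂ (γ • τ) =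
      k * siegel (a₁ * γ 0 0 + a₂ * γ 1 0) (a₁ * γ 0 1 + a₂ * γ 1 1) τ) {C D : ℤ}
    (hC : γ 1 0 = p * C) (hD : γ 1 1 = 1 + p * D) (u : ℤ) (τ : ℍ) :
    levelSiegel p 0 u (γ • τ) = k * zeta p ^ (-(2 * C * u ^ 2)) * levelSiegel p 0 u τ := by
  have h := levelSiegel_add p 0 u (u * C) (u * D) τ
  rw [levelSiegel_smul p hk, hC, hD, mul_assoc]
  rw [show (0 : ℤ) * γ 0 0 + u * (p * C) = 0 + p * (u * C) by ring,
    show 0 * γ 0 1 + u * (1 + p * D) = u + p * (u * D) by ring, h]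
  congr 3
  ring

/-- Modulo `p`, `γ` sends `(u, x)` to `(u, x + ub)`, a permutation of the factors. The exponents of
`ζ` are quadratic in `x` apart from the carries `n x`; summed over `ZMod p`, only the carries
survive. -/
lemma levelProd_smul {p : ℕ} [Fact p.Prime] (hp5 : 5 ≤ p) {γ : SL(2, ℤ)} {k : ℂ}
    (hk : ∀ (a₁ a₂ : ℚ) (τ : ℍ), siegel a₁ a₂ (γ • τ) =
      k * siegel (a₁ * γ 0 0 + a₂ * γ 1 0) (a₁ * γ 0 1 + a₂ * γ 1 1) τ) {A C D : ℤ}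
    (hA : γ 0 0 = 1 + p * A) (hC : γ 1 0 = p * C) (hD : γ 1 1 = 1 + p * D) (u : ℤ) (τ : ℍ) :
    levelProd p u (γ • τ) = k ^ p * zeta p ^ (2 * γ 0 1 * u ^ 2) * levelProd p u τ := by
  set b := γ 0 1 with hb
  have hp0 : (p : ℤ) ≠ 0 := NeZero.ne _
  have hy : ∀ x : ZMod p, ∃ n : ℤ, u * b + x.val = (x + (u * b : ℤ)).val + p * n := by
    intro x
    obtain ⟨n, hn⟩ := (ZMod.intCast_zmod_eq_zero_iff_dvd
      (u * b + x.val - (x + (u * b : ℤ)).val) p).mp (by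
        push_cast
        rw [ZMod.natCast_zmod_val, ZMod.natCast_zmod_val]; ring)
    exact ⟨n, by linarith⟩
  choose n hn using hy
  have hreindex : ∀ {M : Type} [CommMonoid M] (g : ZMod p → M),
      ∏ x, g (x + (u * b : ℤ)) = ∏ x, g x := fun g ↦
    Equiv.prod_comp (Equiv.addRight ((u * b : ℤ) : ZMod p)) g
  have hreindex' : ∀ (g : ZMod p → ℤ), ∑ x, g (x + (u * b : ℤ)) = ∑ x, g x := fun g ↦
    Equiv.sum_comp (Equiv.addRight ((u * b : ℤ) : ZMod p)) g
  -- Both sides of `hn` are summed: the representatives are merely permuted, so the carries total `p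
  -- * (u * b)` divided by `p`.
  have hsum_n : ∑ x, n x = u * b := by
    have h1 : ∑ x : ZMod p, (u * b + (x.val : ℤ)) =
        ∑ x : ZMod p, (((x + (u * b : ℤ)).val : ℤ) + p * n x) :=
      Finset.sum_congr rfl fun x _ ↦ hn x
    rw [Finset.sum_add_distrib, Finset.sum_add_distrib,
      hreindex' fun x ↦ (x.val : ℤ), Finset.sum_const, Finset.card_univ, ZMod.card,
      nsmul_eq_mul] at h1
    have h2 : (p : ℤ) * ∑ x, n x = p * (u * b) := by
      rw [Finset.mul_sum]
      linear_combination -h1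
    exact mul_left_cancel₀ hp0 h2
  have hterm : ∀ x : ZMod p, levelSiegel p u (x.val : ℤ) (γ • τ) =
      k * (zeta p ^ (2 * ((n x + x.val * D) * u -
        (u * A + x.val * C) * (x + (u * b : ℤ)).val)) *
          levelSiegel p u ((x + (u * b : ℤ)).val : ℤ) τ) := by
    intro x
    rw [levelSiegel_smul p hk, ← levelSiegel_add, hA, hC, hD, ← hb]
    congr 2
    · ring
    · linear_combination hn x
  have hzeta : ∏ x : ZMod p, zeta p ^ (2 * ((n x + x.val * D) * u -
        (u * A + x.val * C) * (x + (u * b : ℤ)).val)) = zeta p ^ (2 * b * u ^ 2) := by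
    rw [prod_zpow_eq_zpow_sum (zeta_ne_zero p)]
    refine zeta_zpow_congr ?_
    have hn' : ∑ x, (n x : ZMod p) = u * b := by
      exact_mod_cast congrArg (Int.cast (R := ZMod p)) hsum_n
    have e : ∀ x : ZMod p, (2 : ZMod p) * ((n x + x * D) * u - (u * A + x * C) * (x + u * b)) =
        2 * u * n x + (2 * D * u - 2 * u * A - 2 * C * u * b) * x + (-2 * C) * x ^ 2 +
          (-2 * u * A * u * b) := by
      intro x; ring
    push_cast
    simp only [ZMod.natCast_zmod_val, e]
    rw [Finset.sum_add_distrib, Finset.sum_add_distrib, Finset.sum_add_distrib, ← Finset.mul_sum,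
      ← Finset.mul_sum, ← Finset.mul_sum, hn', sum_zmod_eq_zero hp5, sum_sq_zmod_eq_zero hp5,
      Finset.sum_const, Finset.card_univ, ZMod.card]
    simp
    ring
  rw [levelProd, Finset.prod_congr rfl fun x _ ↦ hterm x, Finset.prod_mul_distrib,
    Finset.prod_mul_distrib, hzeta, hreindex fun x ↦ levelSiegel p u (x.val : ℤ) τ,
    Finset.prod_const, Finset.card_univ, ZMod.card, ← mul_assoc]
  rfl

lemma smul_of_eqUpToConst {f g : ℍ → ℂ} (h : EqUpToConst f g) {γ : SL(2, ℤ)} {c : ℂ}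
    (hg : ∀ τ, g (γ • τ) = c * g τ) (τ : ℍ) : f (γ • τ) = c * f τ := by
  obtain ⟨d, -, h⟩ := h
  rw [h, h, hg]; ring

lemma exists_half_pow {p : ℕ} [Fact p.Prime] (hp5 : 5 ≤ p) (α : ℤ) :
    ∃ u : ℕ → ℤ, ∀ i, (α : ZMod p) ^ i = 2 * (u i : ZMod p) := by
  refine ⟨fun i ↦ ((2 : ZMod p)⁻¹ * (α : ZMod p) ^ i).val, fun i ↦ ?_⟩
  rw [Int.cast_natCast, ZMod.natCast_zmod_val, mul_inv_cancel_left₀ (two_ne_zero_zmod hp5)]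

/-- The transformation law of `∏ E_i^{e_i} F_i^{f_i}` under `Γ₁(p)`. -/
theorem unitProduct_smul {p : ℕ} [Fact p.Prime] (hp5 : 5 ≤ p) {α : ℤ}
    (hα : orderOf (α : ZMod p) = p - 1) (e f : Fin ((p - 1) / 2) → ℤ)
    {u : ℕ → ℤ} (hu : ∀ i, (α : ZMod p) ^ i = 2 * (u i : ZMod p)) {γ : SL(2, ℤ)} {k : ℂ}
    (hk0 : k ≠ 0) (hk : ∀ (a₁ a₂ : ℚ) (τ : ℍ), siegel a₁ a₂ (γ • τ) =
      k * siegel (a₁ * γ 0 0 + a₂ * γ 1 0) (a₁ * γ 0 1 + a₂ * γ 1 1) τ) {A C D : ℤ}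
    (hA : γ 0 0 = 1 + p * A) (hC : γ 1 0 = p * C) (hD : γ 1 1 = 1 + p * D) (τ : ℍ) :
    unitProduct p α e f (γ • τ) = k ^ (∑ i, ((p : ℤ) * e i + f i)) *
      zeta p ^ (2 * (γ 0 1 * ∑ i, e i * u i ^ 2 - C * ∑ i, f i * u i ^ 2)) *
        unitProduct p α e f τ := by
  have hterm : ∀ i : Fin ((p - 1) / 2),
      E p α i (γ • τ) ^ e i * F p α i (γ • τ) ^ f i =
        k ^ ((p : ℤ) * e i + f i) * zeta p ^ (2 * (γ 0 1 * (e i * u i ^ 2) - C * (f i * u i ^ 2))) *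
          (E p α i τ ^ e i * F p α i τ ^ f i) := by
    intro i
    rw [smul_of_eqUpToConst (E_eqUpToConst hp5 hα (hu i)) (levelProd_smul hp5 hk hA hC hD (u i)) τ,
      smul_of_eqUpToConst (F_eqUpToConst (hu i)) (levelSiegel_zero_smul hk hC hD (u i)) τ,
      show 2 * (γ 0 1 * (e i * u i ^ 2) - C * (f i * u i ^ 2)) =
        (2 * γ 0 1 * u i ^ 2) * e i + (-(2 * C * u i ^ 2)) * f i by ring,
      zpow_add₀ hk0, zpow_add₀ (zeta_ne_zero p), zpow_mul k,
      zpow_mul _ (2 * γ 0 1 * u i ^ 2), zpow_mul _ (-(2 * C * u i ^ 2)), zpow_natCast, mul_zpow,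
      mul_zpow, mul_zpow, mul_zpow]
    generalize (zeta p ^ (2 * γ 0 1 * u i ^ 2)) ^ e i = x
    generalize (zeta p ^ (-(2 * C * u i ^ 2))) ^ f i = y
    ring
  rw [unitProduct, Finset.prod_congr rfl fun i _ ↦ hterm i, Finset.prod_mul_distrib,
    Finset.prod_mul_distrib, prod_zpow_eq_zpow_sum hk0,
    prod_zpow_eq_zpow_sum (zeta_ne_zero p), ← Finset.mul_sum,
    Finset.sum_sub_distrib, ← Finset.mul_sum, ← Finset.mul_sum]
  rfl

/-! ### The congruences -/

lemma pow_div_not_int {p : ℕ} [Fact p.Prime] (hp5 : 5 ≤ p) {α : ℤ}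
    (hα : orderOf (α : ZMod p) = p - 1) (i : ℕ) (m : ℤ) : (α : ℚ) ^ i / p ≠ m := by
  intro h
  have hp : (p : ℚ) ≠ 0 := NeZero.ne _
  have h1 : α ^ i = m * p := by
    rw [div_eq_iff hp] at h
    exact_mod_cast h
  have h2 : (α : ZMod p) ^ i = 0 := by
    have := congrArg (Int.cast (R := ZMod p)) h1
    simpa using this
  have h3 : (α : ZMod p) = 0 := eq_zero_of_pow_eq_zero h2
  have h4 := pow_orderOf_eq_one (α : ZMod p)
  rw [hα, h3, zero_pow (by omega)] at h4
  exact zero_ne_one h4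

lemma E_ne_zero {p : ℕ} [Fact p.Prime] (hp5 : 5 ≤ p) {α : ℤ}
    (hα : orderOf (α : ZMod p) = p - 1) (i : ℕ) (τ : ℍ) : E p α i τ ≠ 0 := by
  have h : ∀ a₂ : ℚ, siegel ((α : ℚ) ^ i / p) a₂ τ ≠ 0 := fun a₂ ↦
    siegel_ne_zero (fun ⟨m, _, h, _⟩ ↦ pow_div_not_int hp5 hα i m h) τ
  exact mul_ne_zero (h 0) (Finset.prod_ne_zero_iff.mpr fun j _ ↦ h _)

lemma F_ne_zero {p : ℕ} [Fact p.Prime] (hp5 : 5 ≤ p) {α : ℤ}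
    (hα : orderOf (α : ZMod p) = p - 1) (i : ℕ) (τ : ℍ) : F p α i τ ≠ 0 :=
  siegel_ne_zero (fun ⟨_, n, _, h⟩ ↦ pow_div_not_int hp5 hα i n h) τ

lemma unitProduct_ne_zero {p : ℕ} [Fact p.Prime] (hp5 : 5 ≤ p) {α : ℤ}
    (hα : orderOf (α : ZMod p) = p - 1) (e f : Fin ((p - 1) / 2) → ℤ) (τ : ℍ) :
    unitProduct p α e f τ ≠ 0 :=
  Finset.prod_ne_zero_iff.mpr fun i _ ↦ mul_ne_zero (zpow_ne_zero _ (E_ne_zero hp5 hα i τ))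
    (zpow_ne_zero _ (F_ne_zero hp5 hα i τ))

lemma mdifferentiable_unitProduct {p : ℕ} [Fact p.Prime] (hp5 : 5 ≤ p) {α : ℤ}
    (hα : orderOf (α : ZMod p) = p - 1) (e f : Fin ((p - 1) / 2) → ℤ) :
    MDifferentiable 𝓘(ℂ) 𝓘(ℂ) (unitProduct p α e f) := by
  rw [UpperHalfPlane.mdifferentiable_iff]
  have hs : ∀ a₁ a₂ : ℚ, DifferentiableOn ℂ (fun z ↦ siegel a₁ a₂ (UpperHalfPlane.ofComplex z))
      {z | 0 < z.im} := fun a₁ a₂ ↦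
    UpperHalfPlane.mdifferentiable_iff.mp (mdifferentiable_siegel a₁ a₂)
  have hE : ∀ i, DifferentiableOn ℂ (fun z ↦ E p α i (UpperHalfPlane.ofComplex z))
      {z | 0 < z.im} := fun i ↦
    (hs _ _).mul (DifferentiableOn.fun_finsetProd fun j _ ↦ hs _ _)
  have hF : ∀ i, DifferentiableOn ℂ (fun z ↦ F p α i (UpperHalfPlane.ofComplex z))
      {z | 0 < z.im} := fun i ↦ hs _ _
  refine DifferentiableOn.fun_finsetProd (u := Finset.univ)
    (f := fun (i : Fin ((p - 1) / 2)) z ↦ E p α i (UpperHalfPlane.ofComplex z) ^ e i *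
      F p α i (UpperHalfPlane.ofComplex z) ^ f i) fun i _ ↦
    ((hE i).zpow (Or.inl fun z _ ↦ E_ne_zero hp5 hα i _)).mul
      ((hF i).zpow (Or.inl fun z _ ↦ F_ne_zero hp5 hα i _))

lemma four_mul_sum_sq {p : ℕ} {α : ℤ} {u : ℕ → ℤ}
    (hu : ∀ i, (α : ZMod p) ^ i = 2 * (u i : ZMod p)) {n : ℕ} (e : Fin n → ℤ) :
    ((∑ i, e i * α ^ (2 * (i : ℕ)) : ℤ) : ZMod p) = 4 * ((∑ i, e i * u i ^ 2 : ℤ) : ZMod p) := by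
  push_cast
  rw [Finset.mul_sum]
  refine Finset.sum_congr rfl fun i _ ↦ ?_
  rw [mul_comm 2, pow_mul, hu]
  ring

lemma sum_modEq_zero_iff {p : ℕ} [Fact p.Prime] (hp5 : 5 ≤ p) {α : ℤ} {u : ℕ → ℤ}
    (hu : ∀ i, (α : ZMod p) ^ i = 2 * (u i : ZMod p)) {n : ℕ} (e : Fin n → ℤ) :
    ∑ i, e i * α ^ (2 * (i : ℕ)) ≡ 0 [ZMOD p] ↔ ((∑ i, e i * u i ^ 2 : ℤ) : ZMod p) = 0 := by
  have h4 : (4 : ZMod p) ≠ 0 := by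
    rw [show (4 : ZMod p) = 2 * 2 by norm_num]
    exact mul_ne_zero (two_ne_zero_zmod hp5) (two_ne_zero_zmod hp5)
  rw [← ZMod.intCast_eq_intCast_iff, four_mul_sum_sq hu, Int.cast_zero, mul_eq_zero,
    or_iff_right h4]

lemma siegel_T_smul' (a₁ a₂ : ℚ) (τ : ℍ) :
    siegel a₁ a₂ (ModularGroup.T • τ) = zeta 12 *
      siegel (a₁ * ModularGroup.T 0 0 + a₂ * ModularGroup.T 1 0)
        (a₁ * ModularGroup.T 0 1 + a₂ * ModularGroup.T 1 1) τ := by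
  rw [siegel_T_smul]
  simp [ModularGroup.T, zeta]

lemma zpow_eq_one_of_modEq_zero {k : ℂ} (hk : k ^ 12 = 1) {m : ℤ} (hm : m ≡ 0 [ZMOD 12]) :
    k ^ m = 1 := by
  obtain ⟨c, rfl⟩ := Int.modEq_zero_iff_dvd.mp hm
  rw [zpow_mul, show (12 : ℤ) = ((12 : ℕ) : ℤ) by norm_num, zpow_natCast, hk, one_zpow]

lemma modEq_zero_of_zeta_mul_eq_one {p : ℕ} (hp : p.Prime) (hp5 : 5 ≤ p) {M A : ℤ}
    (h : zeta 12 ^ M * zeta p ^ (2 * A) = 1) : M ≡ 0 [ZMOD 12] ∧ (A : ZMod p) = 0 := by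
  have : Fact p.Prime := ⟨hp⟩
  have hp0 : p ≠ 0 := hp.ne_zero
  have hz12 : IsPrimitiveRoot (zeta 12) 12 := isPrimitiveRoot_zeta 12
  have hzp := isPrimitiveRoot_zeta p
  have hM : M ≡ 0 [ZMOD 12] := by
    -- The `p`-th power kills the factor of order dividing `p`, and `p` is prime to 12.
    have h1 : (zeta 12 ^ M * zeta p ^ (2 * A)) ^ (p : ℤ) = 1 := by rw [h, one_zpow]
    rw [mul_zpow, ← zpow_mul, ← zpow_mul,
      (hzp.zpow_eq_one_iff_dvd _).mpr (Dvd.intro_left _ rfl), mul_one] at h1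
    have h2 := (hz12.zpow_eq_one_iff_dvd _).mp h1
    have hco : IsCoprime ((12 : ℕ) : ℤ) (p : ℤ) := by
      rw [Nat.isCoprime_iff_coprime]
      have h2p : Nat.Coprime 2 p := (Nat.coprime_primes Nat.prime_two hp).mpr (by omega)
      have h3p : Nat.Coprime 3 p := (Nat.coprime_primes Nat.prime_three hp).mpr (by omega)
      exact (h2p.mul_left h2p).mul_left h3p
    exact Int.modEq_zero_iff_dvd.mpr (hco.dvd_of_dvd_mul_right h2)
  refine ⟨hM, ?_⟩
  rw [zpow_eq_one_of_modEq_zero hz12.pow_eq_one hM, one_mul] at h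
  have h1 := (ZMod.intCast_zmod_eq_zero_iff_dvd _ p).mpr ((hzp.zpow_eq_one_iff_dvd _).mp h)
  push_cast at h1
  exact (mul_eq_zero.mp h1).resolve_left (two_ne_zero_zmod hp5)

/-- The lower triangular matrix with lower left entry `p`. -/
def lowerMatrix (p : ℕ) : SL(2, ℤ) := ⟨!![1, 0; p, 1], by simp [Matrix.det_fin_two_of]⟩

lemma lowerMatrix_mem_Gamma1 (p : ℕ) : lowerMatrix p ∈ CongruenceSubgroup.Gamma1 p := by
  rw [CongruenceSubgroup.Gamma1_mem]
  simp [lowerMatrix]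

lemma T_mem_Gamma1 (p : ℕ) : ModularGroup.T ∈ CongruenceSubgroup.Gamma1 p := by
  rw [CongruenceSubgroup.Gamma1_mem]
  simp [ModularGroup.T]

theorem isModularUnit_unitProduct_iff {p : ℕ} (hp : p.Prime) (hp5 : 5 ≤ p) {α : ℤ}
    (hα : orderOf (α : ZMod p) = p - 1) (e f : Fin ((p - 1) / 2) → ℤ) :
    IsModularUnit (CongruenceSubgroup.Gamma1 p) (unitProduct p α e f) ↔
      (∑ i, e i * α ^ (2 * (i : ℕ)) ≡ 0 [ZMOD p]) ∧
      (∑ i, f i * α ^ (2 * (i : ℕ)) ≡ 0 [ZMOD p]) ∧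
      (∑ i, ((p : ℤ) * e i + f i) ≡ 0 [ZMOD 12]) := by
  have : Fact p.Prime := ⟨hp⟩
  obtain ⟨u, hu⟩ := exists_half_pow hp5 α
  rw [sum_modEq_zero_iff hp5 hu, sum_modEq_zero_iff hp5 hu]
  constructor
  · intro h
    -- For `T` the constant is explicitly `zeta 12`, a primitive twelfth root of unity, so its
    -- exponent can be recovered mod 12.
    have hT := unitProduct_smul hp5 hα e f hu (zeta_ne_zero 12) siegel_T_smul'
      (A := 0) (C := 0) (D := 0) (by simp [ModularGroup.T]) (by simp [ModularGroup.T])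
      (by simp [ModularGroup.T]) UpperHalfPlane.I
    rw [h.invariant _ (T_mem_Gamma1 p), right_eq_mul₀ (unitProduct_ne_zero hp5 hα e f _)] at hT
    simp only [zero_mul, sub_zero, ModularGroup.T, Matrix.of_apply, Matrix.cons_val_zero,
      Matrix.cons_val_one, Matrix.cons_val_fin_one, one_mul] at hT
    obtain ⟨hM, he⟩ := modEq_zero_of_zeta_mul_eq_one hp hp5 hT
    refine ⟨he, ?_, hM⟩
    -- Here `k` need not be known: the congruence mod 12 just obtained removes it.
    obtain ⟨k, hk12, hk⟩ := exists_siegel_smul (lowerMatrix p)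
    have hk0 : k ≠ 0 := by rintro rfl; norm_num at hk12
    have hL := unitProduct_smul hp5 hα e f hu hk0 hk (A := 0) (C := 1) (D := 0)
      (by simp [lowerMatrix]) (by simp [lowerMatrix]) (by simp [lowerMatrix]) UpperHalfPlane.I
    rw [h.invariant _ (lowerMatrix_mem_Gamma1 p),
      right_eq_mul₀ (unitProduct_ne_zero hp5 hα e f _), zpow_eq_one_of_modEq_zero hk12 hM,
      one_mul] at hL
    have h1 := modEq_zero_of_zeta_mul_eq_one hp hp5 (M := 0) (by rw [zpow_zero, one_mul]; exact hL)
    have h2 := h1.2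
    simpa [lowerMatrix] using h2
  · rintro ⟨he, hf, hM⟩
    refine ⟨mdifferentiable_unitProduct hp5 hα e f, unitProduct_ne_zero hp5 hα e f,
      fun γ hγ τ ↦ ?_⟩
    obtain ⟨A, C, D, hA, hC, hD⟩ := Gamma1_entries hγ
    obtain ⟨k, hk12, hk⟩ := exists_siegel_smul γ
    have hk0 : k ≠ 0 := by rintro rfl; norm_num at hk12
    have hz : ((2 * (γ 0 1 * ∑ i, e i * u i ^ 2 - C * ∑ i, f i * u i ^ 2) : ℤ) : ZMod p) =
        (0 : ℤ) := by
      rw [Int.cast_mul, Int.cast_sub, Int.cast_mul, Int.cast_mul, he, hf]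
      simp
    rw [unitProduct_smul hp5 hα e f hu hk0 hk hA hC hD, zpow_eq_one_of_modEq_zero hk12 hM,
      zeta_zpow_congr hz, zpow_zero, one_mul, one_mul]

/-! ### Behaviour at the cusps -/

/-- `g` is comparable to a power of `e^{Im τ}` at `i∞`. -/
def HasExpGrowth (g : ℍ → ℂ) : Prop :=
  ∃ N : ℝ, g =Θ[UpperHalfPlane.atImInfty] fun τ : ℍ ↦ Real.exp (N * τ.im)

lemma HasExpGrowth.mul {f g : ℍ → ℂ} (hf : HasExpGrowth f) (hg : HasExpGrowth g) :
    HasExpGrowth fun τ ↦ f τ * g τ := by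
  obtain ⟨N, hN⟩ := hf
  obtain ⟨M, hM⟩ := hg
  refine ⟨N + M, ?_⟩
  simp_rw [add_mul, Real.exp_add]
  exact hN.mul hM

/-- Negative exponents are the reason for asking two-sided comparability rather than an upper bound.
-/
lemma HasExpGrowth.zpow {f : ℍ → ℂ} (hf : HasExpGrowth f) (n : ℤ) :
    HasExpGrowth fun τ ↦ f τ ^ n := by
  obtain ⟨N, hN⟩ := hf
  refine ⟨n * N, ?_⟩
  have h : ∀ x : ℝ, Real.exp (n * N * x) = Real.exp (N * x) ^ n := fun x ↦ by
    rw [← Real.rpow_intCast, ← Real.exp_mul]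
    ring_nf
  simp_rw [h]
  exact hN.zpow n

lemma HasExpGrowth.prod {ι : Type*} (s : Finset ι) {f : ι → ℍ → ℂ}
    (h : ∀ i ∈ s, HasExpGrowth (f i)) : HasExpGrowth fun τ ↦ ∏ i ∈ s, f i τ := by
  classical
  induction s using Finset.induction_on with
  | empty => exact ⟨0, by simp [isTheta_const_const_iff]⟩
  | insert a s ha ih =>
    simp only [Finset.prod_insert ha]
    exact (h a (Finset.mem_insert_self a s)).mul
      (ih fun i hi ↦ h i (Finset.mem_insert_of_mem hi))

lemma HasExpGrowth.of_eqUpToConst {f g : ℍ → ℂ} (h : EqUpToConst f g) (hg : HasExpGrowth g) :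
    HasExpGrowth f := by
  obtain ⟨c, hc, h⟩ := h
  obtain ⟨N, hN⟩ := hg
  refine ⟨N, ?_⟩
  rw [show f = fun τ ↦ c * g τ from funext h]
  exact (isTheta_const_mul_left hc).mpr hN

lemma HasExpGrowth.of_tendsto {f : ℍ → ℂ} {L : ℂ} (hL : L ≠ 0)
    (h : Tendsto f UpperHalfPlane.atImInfty (𝓝 L)) : HasExpGrowth f := by
  refine ⟨0, ?_⟩
  have h1 := ((isEquivalent_const_iff_tendsto hL).mpr h).isTheta
  simp only [zero_mul, Real.exp_zero]
  exact h1.trans (isTheta_const_const hL one_ne_zero)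

lemma norm_exp_linear (r : ℚ) (c : ℚ) (τ : ℍ) :
    ‖Complex.exp (2 * π * Complex.I * (r * τ + c))‖ = Real.exp (-(2 * π * r) * τ.im) := by
  rw [Complex.norm_exp]
  congr 1
  have e1 : (r : ℂ) = ((r : ℝ) : ℂ) := by push_cast; rfl
  have e2 : (c : ℂ) = ((c : ℝ) : ℂ) := by push_cast; rfl
  have e3 : (2 * π * Complex.I * (r * τ + c) : ℂ) =
      ((2 * π : ℝ) : ℂ) * ((r * τ + c) * Complex.I) := by
    push_cast; ring
  rw [e3, Complex.re_ofReal_mul, Complex.mul_I_re, e1, e2, Complex.add_im, Complex.im_ofReal_mul,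
    Complex.ofReal_im, UpperHalfPlane.coe_im]
  ring

lemma hasExpGrowth_exp (r : ℚ) :
    HasExpGrowth fun τ ↦ Complex.exp (2 * π * Complex.I * (r : ℂ) * (τ : ℂ)) := by
  refine ⟨-(2 * π * r), IsTheta.of_norm_eventuallyEq (Eventually.of_forall fun τ ↦ ?_)⟩
  have e : (2 * π * Complex.I * (r : ℂ) * (τ : ℂ)) =
      2 * π * Complex.I * (r * τ + (0 : ℚ)) := by push_cast; ring
  simp only [e, norm_exp_linear]

lemma tendsto_exp_linear {r : ℚ} (hr : 0 < r) (c : ℚ) :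
    Tendsto (fun τ : ℍ ↦ Complex.exp (2 * π * Complex.I * (r * τ + c))) UpperHalfPlane.atImInfty
      (𝓝 0) := by
  rw [tendsto_zero_iff_norm_tendsto_zero]
  simp_rw [norm_exp_linear]
  have him : Tendsto UpperHalfPlane.im UpperHalfPlane.atImInfty atTop := tendsto_comap
  refine Real.tendsto_exp_atBot.comp (him.const_mul_atTop_of_neg ?_)
  have : (0 : ℝ) < r := by exact_mod_cast hr
  have := Real.pi_pos
  rw [neg_lt_zero]
  positivity

/-- An infinite product `∏ (1 - e^{2πi((n + r)τ + c)})` tends to `1` at `i∞` if `r > 0`. -/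
lemma tendsto_tprod_exp {r : ℚ} (hr : 0 < r) (c : ℚ) :
    Tendsto (fun τ : ℍ ↦ ∏' n : ℕ, (1 + -Complex.exp (2 * π * Complex.I * ((n + r : ℚ) * τ + c))))
      UpperHalfPlane.atImInfty (𝓝 1) := by
  have h := tendsto_tprod_one_add_of_dominated_convergence (𝓕 := UpperHalfPlane.atImInfty)
    (f := fun (τ : ℍ) (n : ℕ) ↦ -Complex.exp (2 * π * Complex.I * ((n + r : ℚ) * τ + c)))
    (g := 0) (bound := fun n : ℕ ↦ Real.exp (-1) ^ n)
    (summable_geometric_of_lt_one (Real.exp_pos _).le (by rw [Real.exp_lt_one_iff]; norm_num))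
    (fun n ↦ by
      have := (tendsto_exp_linear (r := n + r) (by positivity) c).neg
      rwa [neg_zero] at this)
    (by
      filter_upwards [(UpperHalfPlane.atImInfty_mem _).mpr ⟨1, fun z hz ↦ hz⟩] with τ hτ n
      have hτ : 1 ≤ τ.im := hτ
      rw [norm_neg, norm_exp_linear, ← Real.exp_nat_mul, Real.exp_le_exp]
      have hr' : (0 : ℝ) < r := by exact_mod_cast hr
      have h1 : (n : ℝ) ≤ 2 * π * (n + r) := by
        nlinarith [Real.pi_gt_three, Nat.cast_nonneg (α := ℝ) n]
      have h2 : 0 ≤ 2 * π * ((n : ℝ) + r) := by positivity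
      push_cast
      nlinarith)
  simpa using h

lemma hasExpGrowth_siegel {a₁ a₂ : ℚ} (h : ¬∃ m n : ℤ, a₁ = m ∧ a₂ = n) :
    HasExpGrowth (siegel a₁ a₂) := by
  -- In this range every `n + 1 ± a₁` is positive, so both infinite products tend to 1 at `i∞`.
  wlog ha : 0 ≤ a₁ ∧ a₁ < 1 generalizing a₁
  · have h1 := siegel_eqUpToConst_add_left (Int.fract a₁) a₂ ⌊a₁⌋
    rw [Int.fract_add_floor] at h1
    refine HasExpGrowth.of_eqUpToConst h1 (this ?_ ⟨Int.fract_nonneg _, Int.fract_lt_one _⟩)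
    rintro ⟨m, n, hm, hn⟩
    refine h ⟨⌊a₁⌋ + m, n, ?_, hn⟩
    have := Int.floor_add_fract a₁
    push_cast
    linarith
  obtain ⟨ha0, ha1⟩ := ha
  have e1 : ∀ τ, siegel a₁ a₂ τ =
      (-Complex.exp (2 * π * Complex.I * ((a₂ : ℂ) * ((a₁ : ℂ) - 1) / 2))) *
        (Complex.exp (2 * π * Complex.I * ((B2 a₁ / 2 : ℚ) : ℂ) * τ) * ((1 - qZ a₁ a₂ τ) *
          ((∏' n : ℕ, (1 + -Complex.exp (2 * π * Complex.I * ((n + (1 + a₁) : ℚ) * τ + a₂)))) *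
            ∏' n : ℕ, (1 + -Complex.exp
              (2 * π * Complex.I * ((n + (1 - a₁) : ℚ) * τ + (-a₂ : ℚ))))))) := by
    intro τ
    have p1 : ∀ n : ℕ, qTau τ ^ (n + 1) * qZ a₁ a₂ τ =
        Complex.exp (2 * π * Complex.I * ((n + (1 + a₁) : ℚ) * τ + a₂)) := by
      intro n
      rw [qTau, qZ, ← Complex.exp_nat_mul, ← Complex.exp_add]
      congr 1; push_cast; ring
    have p2 : ∀ n : ℕ, qTau τ ^ (n + 1) / qZ a₁ a₂ τ =
        Complex.exp (2 * π * Complex.I * ((n + (1 - a₁) : ℚ) * τ + (-a₂ : ℚ))) := by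
      intro n
      rw [qTau, qZ, ← Complex.exp_nat_mul, ← Complex.exp_sub]
      congr 1; push_cast; ring
    rw [siegel, tprod_siegel_eq]
    simp_rw [p1, p2]
    rw [Rat.cast_div, Rat.cast_ofNat]
    ring
  refine HasExpGrowth.of_eqUpToConst ⟨_, neg_ne_zero.mpr (Complex.exp_ne_zero _), e1⟩
    ((hasExpGrowth_exp _).mul (HasExpGrowth.mul ?_ (HasExpGrowth.mul
      (.of_tendsto one_ne_zero (tendsto_tprod_exp (by linarith) _))
      (.of_tendsto one_ne_zero (tendsto_tprod_exp (by linarith) _)))))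
  -- For `a₁ = 0` the factor `1 - q_z` is constant, non-zero because `a₂` is not an integer;
  -- otherwise it tends to 1.
  rcases ha0.eq_or_lt with h0 | h0
  · subst h0
    refine .of_tendsto (L := 1 - qZ 0 a₂ UpperHalfPlane.I) ?_ ?_
    · rw [sub_ne_zero]
      have := exp_ne_one_of_not_int h 0 UpperHalfPlane.I
      simpa [qZ] using this.symm
    · have : (fun τ ↦ 1 - qZ 0 a₂ τ) = fun _ ↦ 1 - qZ 0 a₂ UpperHalfPlane.I := by
        funext τ
        simp [qZ]
      rw [this]
      exact tendsto_const_nhds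
  · have := (tendsto_exp_linear h0 a₂).const_sub 1
    rw [sub_zero] at this
    exact .of_tendsto one_ne_zero this

lemma hasExpGrowth_siegel_smul {a₁ a₂ : ℚ} (h : ¬∃ m n : ℤ, a₁ = m ∧ a₂ = n) (γ : SL(2, ℤ)) :
    HasExpGrowth fun τ ↦ siegel a₁ a₂ (γ • τ) := by
  obtain ⟨k, hk12, hk⟩ := exists_siegel_smul γ
  have hk0 : k ≠ 0 := by rintro rfl; norm_num at hk12
  refine HasExpGrowth.of_eqUpToConst ⟨k, hk0, hk a₁ a₂⟩ (hasExpGrowth_siegel ?_)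
  -- If `aγ` were integral, so would be `a = (aγ)γ⁻¹`.
  rintro ⟨m, n, hm, hn⟩
  have hdet : (γ 0 0 : ℚ) * γ 1 1 - γ 0 1 * γ 1 0 = 1 := by
    have := γ.det_coe
    rw [Matrix.det_fin_two] at this
    exact_mod_cast this
  refine h ⟨m * γ 1 1 - n * γ 1 0, n * γ 0 0 - m * γ 0 1, ?_, ?_⟩
  · push_cast
    linear_combination (γ 1 1 : ℚ) * hm - (γ 1 0 : ℚ) * hn - a₁ * hdet
  · push_cast
    linear_combination (γ 0 0 : ℚ) * hn - (γ 0 1 : ℚ) * hm - a₂ * hdet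

/-- A holomorphic function on the upper half plane with period `h` and exponential growth at `i∞`
is a meromorphic function of `e^{2πiτ/h}` near `i∞`. -/
lemma exists_meromorphicAt_of_hasExpGrowth {g : ℍ → ℂ} {h : ℕ} (hh : 0 < h)
    (hol : MDifferentiable 𝓘(ℂ) 𝓘(ℂ) g) (hper : ∀ τ : ℍ, g ((h : ℝ) +ᵥ τ) = g τ)
    (hg : HasExpGrowth g) :
    ∃ φ : ℂ → ℂ, MeromorphicAt φ 0 ∧
      ∀ τ : ℍ, g τ = φ (Complex.exp (2 * π * Complex.I * (τ : ℂ) / h)) := by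
  obtain ⟨N, hN⟩ := hg
  obtain ⟨M, hM⟩ := exists_nat_ge N
  have hh0 : (h : ℂ) ≠ 0 := by exact_mod_cast hh.ne'
  have hhR : (0 : ℝ) < h := by exact_mod_cast hh
  -- The factor `e^{2πiMz}` absorbs the growth because `2πM ≥ M ≥ N`. As `M` is an integer it keeps
  -- the period, so `G` extends analytically to the cusp; dividing by `t ^ (h * M)` recovers `g`.
  set G : ℂ → ℂ := fun z ↦ g (UpperHalfPlane.ofComplex z) * Complex.exp (2 * π * Complex.I * M * z)
    with hG
  have hGper : Function.Periodic G ((h : ℝ) : ℂ) := by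
    intro z
    have h1 : Complex.exp (2 * π * Complex.I * M * (z + (h : ℝ))) =
        Complex.exp (2 * π * Complex.I * M * z) := by
      rw [Complex.exp_eq_exp_iff_exists_int]
      refine ⟨M * h, ?_⟩
      push_cast; ring
    have h2 : g (UpperHalfPlane.ofComplex (z + (h : ℝ))) = g (UpperHalfPlane.ofComplex z) := by
      by_cases hz : 0 < z.im
      · have hz' : 0 < (z + (h : ℝ)).im := by simpa using hz
        rw [UpperHalfPlane.ofComplex_apply_of_im_pos hz,
          UpperHalfPlane.ofComplex_apply_of_im_pos hz', ← hper ⟨z, hz⟩]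
        congr 1
        ext
        simp [add_comm]
      -- Off the upper half plane `ofComplex` takes one fixed default value, so periodicity is
      -- trivial there.
      · have hz' : (z + (h : ℝ)).im ≤ 0 := by simpa using hz
        rw [UpperHalfPlane.ofComplex_apply_of_im_nonpos (not_lt.mp hz),
          UpperHalfPlane.ofComplex_apply_of_im_nonpos hz']
    simp only [hG, h1, h2]
  have hGdiff : ∀ z : ℂ, 0 < z.im → DifferentiableAt ℂ G z := by
    intro z hz
    have h1 := (UpperHalfPlane.mdifferentiable_iff.mp hol).differentiableAt
      (UpperHalfPlane.isOpen_upperHalfPlaneSet.mem_nhds hz)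
    exact DifferentiableAt.mul h1 (by fun_prop)
  have hGhol : ∀ᶠ z in comap Complex.im atTop, DifferentiableAt ℂ G z := by
    filter_upwards [preimage_mem_comap (Ioi_mem_atTop 0)] with z hz using hGdiff z hz
  have hGbd : BoundedAtFilter (comap Complex.im atTop) G := by
    have h1 : (fun τ : ℍ ↦ g τ * Complex.exp (2 * π * Complex.I * M * τ))
        =O[UpperHalfPlane.atImInfty] fun _ ↦ (1 : ℝ) := by
      have h2 : (fun τ : ℍ ↦ Complex.exp (2 * π * Complex.I * M * τ))
          =O[UpperHalfPlane.atImInfty] fun τ : ℍ ↦ Real.exp (-(2 * π * M) * τ.im) :=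
        IsBigO.of_bound 1 (Eventually.of_forall fun τ ↦ by
          have := norm_exp_linear M 0 τ
          rw [one_mul, Real.norm_eq_abs, Real.abs_exp]
          refine le_of_eq (Eq.trans ?_ (this.trans ?_))
          · congr 2; push_cast; ring
          · push_cast; rfl)
      refine (hN.1.mul h2).trans (IsBigO.of_bound 1 (Eventually.of_forall fun τ ↦ ?_))
      rw [← Real.exp_add, Real.norm_eq_abs, Real.abs_exp, norm_one, mul_one, Real.exp_le_one_iff]
      have := τ.im_pos
      have hM0 : (0 : ℝ) ≤ M := Nat.cast_nonneg _
      have h3 : N ≤ 2 * π * M := by nlinarith [Real.pi_gt_three]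
      nlinarith
    have h4 := h1.comp_tendsto UpperHalfPlane.tendsto_comap_im_ofComplex
    refine h4.congr' ?_ EventuallyEq.rfl
    filter_upwards [preimage_mem_comap (Ioi_mem_atTop 0)] with z hz
    simp only [Function.comp_apply, hG, UpperHalfPlane.ofComplex_apply_of_im_pos hz]
  set c := Function.Periodic.cuspFunction (h : ℝ) G with hc
  have hcan : AnalyticAt ℂ c 0 := by
    rw [Complex.analyticAt_iff_eventually_differentiableAt]
    have h1 := Function.Periodic.eventually_differentiableAt_cuspFunction_nhds_ne_zero hhR hGper
      hGhol
    have h2 := Function.Periodic.differentiableAt_cuspFunction_zero hhR hGper hGhol hGbd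
    rw [eventually_nhdsWithin_iff] at h1
    filter_upwards [h1] with q hq
    by_cases hq0 : q = 0
    · rw [hq0]; exact h2
    · exact hq hq0
  refine ⟨fun t ↦ c t * (t ^ (h * M))⁻¹,
    hcan.meromorphicAt.mul ((analyticAt_id.pow _).meromorphicAt.inv), fun τ ↦ ?_⟩
  have h1 := Function.Periodic.eq_cuspFunction hhR.ne' hGper τ
  have h2 : Function.Periodic.qParam (h : ℝ) τ =
      Complex.exp (2 * π * Complex.I * (τ : ℂ) / h) := by
    simp [Function.Periodic.qParam]
  have h3 : Complex.exp (2 * π * Complex.I * (τ : ℂ) / h) ^ (h * M) =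
      Complex.exp (2 * π * Complex.I * M * τ) := by
    rw [← Complex.exp_nat_mul]
    congr 1; push_cast; field_simp
  rw [h2] at h1
  simp only [h3]
  rw [hc, h1]
  simp only [hG, UpperHalfPlane.ofComplex_apply]
  rw [mul_inv_cancel_right₀ (Complex.exp_ne_zero _)]

lemma hasExpGrowth_unitProduct_smul {p : ℕ} [Fact p.Prime] (hp5 : 5 ≤ p) {α : ℤ}
    (hα : orderOf (α : ZMod p) = p - 1) (e f : Fin ((p - 1) / 2) → ℤ) (γ : SL(2, ℤ)) :
    HasExpGrowth fun τ ↦ unitProduct p α e f (γ • τ) := by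
  have hE : ∀ i, HasExpGrowth fun τ ↦ E p α i (γ • τ) := by
    intro i
    have h : ∀ a₂ : ℚ, HasExpGrowth fun τ ↦ siegel ((α : ℚ) ^ i / p) a₂ (γ • τ) := fun a₂ ↦
      hasExpGrowth_siegel_smul (fun ⟨m, _, h, _⟩ ↦ pow_div_not_int hp5 hα i m h) γ
    exact (h 0).mul (HasExpGrowth.prod _ fun j _ ↦ h _)
  have hF : ∀ i, HasExpGrowth fun τ ↦ F p α i (γ • τ) := fun i ↦
    hasExpGrowth_siegel_smul (fun ⟨_, n, _, h⟩ ↦ pow_div_not_int hp5 hα i n h) γ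
  exact HasExpGrowth.prod _ fun i _ ↦ ((hE i).zpow (e i)).mul ((hF i).zpow (f i))

lemma T_zpow_mem_Gamma (p : ℕ) : ModularGroup.T ^ (p : ℤ) ∈ CongruenceSubgroup.Gamma p :=
  CongruenceSubgroup.ModularGroup_T_pow_mem_Gamma p p dvd_rfl

lemma Gamma_le_Gamma1 (p : ℕ) : CongruenceSubgroup.Gamma p ≤ CongruenceSubgroup.Gamma1 p := by
  intro γ hγ
  rw [CongruenceSubgroup.Gamma_mem] at hγ
  exact (CongruenceSubgroup.Gamma1_mem p γ).mpr ⟨hγ.1, hγ.2.2.2, hγ.2.2.1⟩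

lemma mdifferentiable_comp_smul {f : ℍ → ℂ} (hf : MDifferentiable 𝓘(ℂ) 𝓘(ℂ) f) (γ : SL(2, ℤ)) :
    MDifferentiable 𝓘(ℂ) 𝓘(ℂ) fun τ ↦ f (γ • τ) :=
  hf.comp (UpperHalfPlane.mdifferentiable_smul (g := (γ : GL (Fin 2) ℝ)) (by simp))

/-- A modular unit for `Γ₁(p)` with exponential growth at every cusp is meromorphic there. -/
lemma IsModularUnit.meromorphicAtCusps {p : ℕ} (hp : 0 < p) {f : ℍ → ℂ}
    (hf : IsModularUnit (CongruenceSubgroup.Gamma1 p) f)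
    (hg : ∀ γ : SL(2, ℤ), HasExpGrowth fun τ ↦ f (γ • τ)) : MeromorphicAtCusps f := by
  intro γ
  have hper : ∀ τ : ℍ, f (γ • ((p : ℝ) +ᵥ τ)) = f (γ • τ) := by
    intro τ
    -- Normality of `Γ(p)` makes `p` a period of `f ∘ γ` for every `γ`, so the same `h = p` serves
    -- at all cusps.
    have hmem : γ * ModularGroup.T ^ (p : ℤ) * γ⁻¹ ∈ CongruenceSubgroup.Gamma1 p :=
      Gamma_le_Gamma1 p ((CongruenceSubgroup.Gamma_normal p).conj_mem _ (T_zpow_mem_Gamma p) γ)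
    have h1 := hf.invariant _ hmem (γ • τ)
    rw [mul_smul, mul_smul, inv_smul_smul, UpperHalfPlane.modular_T_zpow_smul] at h1
    exact_mod_cast h1
  obtain ⟨φ, hφ, h⟩ := exists_meromorphicAt_of_hasExpGrowth hp
    (mdifferentiable_comp_smul hf.holomorphic γ) hper (hg γ)
  exact ⟨p, φ, hp, hφ, Eventually.of_forall h⟩

end ModularUnits

end

theorem mainTheorem5 (p : ℕ) (hp : p.Prime) (hp5 : 5 ≤ p)
    (α : ℤ) (hα : orderOf (α : ZMod p) = p - 1)
    (e f : Fin ((p - 1) / 2) → ℤ) :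
    (ModularUnits.IsModularUnit (CongruenceSubgroup.Gamma1 p)
        (ModularUnits.unitProduct p α e f) ↔
      (∑ i, e i * α ^ (2 * (i : ℕ)) ≡ 0 [ZMOD p]) ∧
      (∑ i, f i * α ^ (2 * (i : ℕ)) ≡ 0 [ZMOD p]) ∧
      (∑ i, ((p : ℤ) * e i + f i) ≡ 0 [ZMOD 12])) ∧
    (ModularUnits.IsModularUnitOnCurve (CongruenceSubgroup.Gamma1 p)
        (ModularUnits.unitProduct p α e f) ↔
      (∑ i, e i * α ^ (2 * (i : ℕ)) ≡ 0 [ZMOD p]) ∧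
      (∑ i, f i * α ^ (2 * (i : ℕ)) ≡ 0 [ZMOD p]) ∧
      (∑ i, ((p : ℤ) * e i + f i) ≡ 0 [ZMOD 12])) := by
  have : Fact p.Prime := ⟨hp⟩
  have h := ModularUnits.isModularUnit_unitProduct_iff hp hp5 hα e f
  exact ⟨h, fun hu ↦ h.mp hu.toIsModularUnit, fun hc ↦ ⟨h.mpr hc,
    (h.mpr hc).meromorphicAtCusps hp.pos
      (ModularUnits.hasExpGrowth_unitProduct_smul hp5 hα e f)⟩⟩
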